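/- Let $S=\bigcup_{n\ge 0}S_n$, where a permutation $\sigma\in S_n$ is identified with the word $\sigma(1)\cdots\sigma(n)$, and let $T=\bigcup_{n\ge0}T_n$, where $T_n$ is the set of standard Young tableaux with entries $1,\dots,n$. For $\sigma\in S_n$ let $P(\sigma)\in T_n$ be its Schensted (row insertion) tableau. For a word $w$ without repeated letters, $st(w)$ is the permutation obtained by replacing its letters by $1,\dots,|w|$ in the order-preserving way, and $w\mid I$ is the word obtained from $w$ by removing the letters that are not in $I$. Let $\mathbb ZS$ and $\mathbb ZT$ be the free $\mathbb Z$-modules on $S$ and $T$. The coproduct of $\mathbb ZS$ is the linear map with $\delta(\sigma)=\sum_{i=0}^{n}\sigma\mid\{1,\dots,i\}\otimes st(\sigma\mid\{i+1,\dots,n\})$ for $\sigma\in S_n$. The coproduct $\delta$ of the Poirier–Reutenauer Hopf algebra $\mathbb ZT$ is the one induced by it: $\delta(P(\sigma))=(P\otimes P)(\delta(\sigma))$ for every permutation $\sigma$. For permutations $u\in S_p$, $v\in S_q$, let $v\bigtriangleup u=\bar v u\in S_{p+q}$ (left shifted concatenation), where $\bar v$ is obtained by adding $p$ to each letter of $v$;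 the left shifted concatenation product of tableaux is the induced one: $P(v)\bigtriangleup P(u)=P(v\bigtriangleup u)$. The weak order on $S_n$ is given by $u\le v$ if and only if each pair $i<j$ of letters such that $j$ is to the left of $i$ in the word $u$ has the same property in $v$. Taskin's weak order $\le$ on $T_n$ is the transitive closure of the relation that holds between $P(u)$ and $P(v)$ whenever $u\le v$ in $S_n$; tableaux of different sizes are incomparable. Then $\delta$ and $\bigtriangleup$ are well defined on $\mathbb ZT$ and $T$ by these formulas. There is exactly one family $(\mathcal M_W)_{W\in T}$ of elements of $\mathbb ZT$ such that $\Sigma=\sum_{W\ge\Sigma}\mathcal M_W$ for all $\Sigma\in T$; it is a basis of $\mathbb ZT$ (the monomial basis), and for every tableau $\Sigma$ $$\delta(\mathcal M_\Sigma)=\sum_{(U,V)\in T\times T,\ V\bigtriangleup U=\Sigma}\mathcal M_U\otimes\mathcal M_V .$$ -/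

import Mathlib

open scoped TensorProduct

namespace TableauHopf

/-! ### Permutations as words -/

/-- A permutation `σ ∈ S_n` (for some `n ≥ 0`), identified with the word `σ(1) σ(2) ⋯ σ(n)`: a word
over the positive integers in which each of `1, …, n` occurs exactly once, `n` being its length. -/
@[ext]
structure PermWord where
  word : List ℕ
  isPerm : word.Perm (List.range' 1 word.length)

theorem perm_range'_of {w : List ℕ} (hd : w.Nodup) (h : ∀ x ∈ w, 1 ≤ x ∧ x ≤ w.length) :
    w.Perm (List.range' 1 w.length) := by
  have hs : w ⊆ List.range' 1 w.length := by
    intro x hx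
    rw [List.mem_range'_1]
    have := h x hx
    omega
  exact (List.subperm_of_subset hd hs).perm_of_length_le (by simp)

theorem PermWord.nodup (σ : PermWord) : σ.word.Nodup :=
  σ.isPerm.nodup_iff.2 List.nodup_range'

theorem PermWord.mem_iff (σ : PermWord) (x : ℕ) :
    x ∈ σ.word ↔ 1 ≤ x ∧ x ≤ σ.word.length := by
  rw [σ.isPerm.mem_iff, List.mem_range'_1]
  omega

/-- The standardization of a word `v` without repeated letters, as a word: each letter `x` is replaced
by its rank `#{y ∈ v : y ≤ x}` among the letters of `v`. -/
def stdWord (v : List ℕ) : List ℕ :=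
  v.map fun x => (v.filter fun y => y ≤ x).length

theorem rank_lt {v : List ℕ} {x y : ℕ} (hy : y ∈ v) (h : x < y) :
    (v.filter fun z => z ≤ x).length < (v.filter fun z => z ≤ y).length := by
  induction v with
  | nil => simp at hy
  | cons a v ih =>
    have mono : (v.filter fun z => z ≤ x).length ≤ (v.filter fun z => z ≤ y).length :=
      (List.monotone_filter_right v (fun z hz => by
        simp only [decide_eq_true_eq] at hz ⊢; omega)).length_le
    rcases List.mem_cons.1 hy with rfl | hy
    · have h1 : ¬ y ≤ x := by omega
      simp [h1]
      omega
    · have := ih hy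
      by_cases h1 : a ≤ x
      · have h2 : a ≤ y := by omega
        simp [h1, h2]
        omega
      · by_cases h2 : a ≤ y
        · simp [h1, h2]
          omega
        · simp [h1, h2]
          omega

/-- The standard permutation `st(v)` of a word `v` without repeated letters. -/
def std (v : List ℕ) (hv : v.Nodup) : PermWord where
  word := stdWord v
  isPerm := by
    apply perm_range'_of
    · refine List.Nodup.map_on ?_ hv
      intro x hx y hy h
      rcases lt_trichotomy x y with hlt | heq | hlt
      · have := rank_lt hy hlt
        omega
      · exact heq
      · have := rank_lt hx hlt
        omega
    · intro z hz
      obtain ⟨x, hx, rfl⟩ := List.mem_map.1 hz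
      refine ⟨List.length_pos_of_mem (a := x) (by simp [hx]), ?_⟩
      simpa [stdWord] using List.length_filter_le (fun y => decide (y ≤ x)) v

/-- `st(σ ∣ {1, …, i})`, which is simply `σ ∣ {1, …, i}`: keep the letters `≤ i`. -/
def PermWord.lower (σ : PermWord) (i : ℕ) : PermWord :=
  std (σ.word.filter fun x => x ≤ i) (σ.nodup.filter _)

/-- `st(σ ∣ {i+1, …, n})`: keep the letters `> i`, then standardize. -/
def PermWord.upper (σ : PermWord) (i : ℕ) : PermWord :=
  std (σ.word.filter fun x => i < x) (σ.nodup.filter _)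

/-- The left shifted concatenation `v △ u = v̄ u`, where `v̄` is obtained from `v` by adding
`|u|` to each letter. -/
def PermWord.tri (v u : PermWord) : PermWord where
  word := v.word.map (fun x => x + u.word.length) ++ u.word
  isPerm := by
    apply perm_range'_of
    · refine List.Nodup.append (v.nodup.map (fun a b h => by simpa using h)) u.nodup ?_
      intro x hx hu
      obtain ⟨y, hy, rfl⟩ := List.mem_map.1 hx
      have h1 := (v.mem_iff y).1 hy
      have h2 := (u.mem_iff _).1 hu
      omega
    · intro x hx
      simp only [List.length_append, List.length_map]
      rcases List.mem_append.1 hx with hx | hx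
      · obtain ⟨y, hy, rfl⟩ := List.mem_map.1 hx
        have h1 := (v.mem_iff y).1 hy
        omega
      · have h2 := (u.mem_iff _).1 hx
        omega

/-- The inversions (by values) of a word: pairs `(j, i)` with `j > i` such that `j` occurs to the left
of `i`. -/
def inversions (w : List ℕ) : Set (ℕ × ℕ) :=
  {p | p.2 < p.1 ∧ [p.1, p.2].Sublist w}

/-- The right weak order on permutations: `u ≤ v` iff `u, v` lie in the same `S_n` and
`Inv(u) ⊆ Inv(v)`. -/
def PermWord.WeakLE (u v : PermWord) : Prop :=
  u.word.length = v.word.length ∧ inversions u.word ⊆ inversions v.word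

/-! ### Standard Young tableaux and the Schensted correspondence -/

/-- `Below r s`: the row `s` can be placed on the row `r` (left justified), that is, `s` is not
longer than `r`, and each entry of `s` is larger than the entry of `r` in the same column. -/
def Below : List ℕ → List ℕ → Prop
  | _, [] => True
  | [], _ :: _ => False
  | a :: r, b :: s => a < b ∧ Below r s

/-- A standard Young tableau, as the list of its (nonempty) rows, starting with the longest one: rows
and columns increase, and the entries are `1, …, n`, each once. -/
@[ext]
structure Tableau where
  rows : List (List ℕ)
  ne_nil : ∀ r ∈ rows, r ≠ []
  row_lt : ∀ r ∈ rows, r.Pairwise (· < ·)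
  col_lt : rows.IsChain Below
  entries : rows.flatten.Perm (List.range' 1 rows.flatten.length)

/-- The number of cells of a tableau; `T_n` is the set of tableaux of size `n`. -/
def Tableau.size (t : Tableau) : ℕ := t.rows.flatten.length

/-- Schensted insertion of `x` in a row: the first entry `y > x` is replaced by `x`, and `y`
is bumped; if there is none, `x` is appended at the end of the row. The result is the new row and the
bumped letter, if any. -/
def rowInsert (x : ℕ) : List ℕ → List ℕ × Option ℕ
  | [] => ([x], none)
  | y :: r => if x < y then (x :: r, some y) else (y :: (rowInsert x r).1, (rowInsert x r).2)

/-- Schensted insertion of `x` in a tableau: insert `x` in the first row, then the bumped letter, if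
any, in the next row, and so on. -/
def insertLetter (x : ℕ) : List (List ℕ) → List (List ℕ)
  | [] => [[x]]
  | r :: t =>
    match (rowInsert x r).2 with
    | none => (rowInsert x r).1 :: t
    | some y => (rowInsert x r).1 :: insertLetter y t

/-- The rows of the Schensted tableau of a word: its letters are inserted from left to right. -/
def schensted (w : List ℕ) : List (List ℕ) :=
  w.foldl (fun t x => insertLetter x t) []

theorem rowInsert_ne_nil (x : ℕ) (r : List ℕ) : (rowInsert x r).1 ≠ [] := by
  cases r with
  | nil => simp [rowInsert]
  | cons a r => simp only [rowInsert]; split_ifs <;> simp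

theorem rowInsert_perm (x : ℕ) (r : List ℕ) :
    ((rowInsert x r).1 ++ (rowInsert x r).2.toList).Perm (x :: r) := by
  induction r with
  | nil => simp [rowInsert]
  | cons a r ih =>
    simp only [rowInsert]
    split_ifs with h
    · simpa using List.perm_append_singleton a r
    · simpa using (ih.cons a).trans (List.Perm.swap x a r)

theorem rowInsert_mem {x z : ℕ} {r : List ℕ} (h : z ∈ (rowInsert x r).1) : z = x ∨ z ∈ r := by
  have := (rowInsert_perm x r).mem_iff (a := z)
  simpa using this.1 (by simp [h])

theorem rowInsert_sorted (x : ℕ) (r : List ℕ) (hr : r.Pairwise (· ≤ ·)) :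
    (rowInsert x r).1.Pairwise (· ≤ ·) := by
  induction r with
  | nil => simp [rowInsert]
  | cons a r ih =>
    rw [List.pairwise_cons] at hr
    simp only [rowInsert]
    split_ifs with h
    · refine List.pairwise_cons.2 ⟨fun z hz => ?_, hr.2⟩
      have := hr.1 z hz
      omega
    · refine List.pairwise_cons.2 ⟨fun z hz => ?_, ih hr.2⟩
      rcases rowInsert_mem hz with rfl | hz
      · omega
      · exact hr.1 z hz

theorem rowInsert_lt {x y : ℕ} {r : List ℕ} (h : (rowInsert x r).2 = some y) : x < y := by
  induction r with
  | nil => simp [rowInsert] at h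
  | cons a r ih =>
    simp only [rowInsert] at h
    split_ifs at h with h1
    · simp only [Option.some.injEq] at h
      omega
    · exact ih h

theorem Below.rowInsert_left {r s : List ℕ} (h : Below r s) (x : ℕ) :
    Below (rowInsert x r).1 s := by
  induction r generalizing s with
  | nil => cases s <;> simp_all [Below]
  | cons a r ih =>
    cases s with
    | nil => simp [Below]
    | cons b s =>
      simp only [Below] at h
      simp only [rowInsert]
      split_ifs with h1
      · exact ⟨by omega, h.2⟩
      · exact ⟨h.1, ih h.2⟩

theorem Below.rowInsert_both {r s : List ℕ} (h : Below r s) {x y : ℕ}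
    (hy : (rowInsert x r).2 = some y) : Below (rowInsert x r).1 (rowInsert y s).1 := by
  induction r generalizing s with
  | nil => simp [rowInsert] at hy
  | cons a r ih =>
    simp only [rowInsert] at hy ⊢
    split_ifs at hy ⊢ with h1
    · simp only [Option.some.injEq] at hy
      subst hy
      cases s with
      | nil => simp [rowInsert, Below, h1]
      | cons b s =>
        simp only [Below] at h
        simp [rowInsert, Below, h.1, h.2, h1]
    · have hlt := rowInsert_lt hy
      cases s with
      | nil => exact ⟨by omega, by simp [Below]⟩
      | cons b s =>
        simp only [Below] at h
        simp only [rowInsert]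
        split_ifs with h2
        · exact ⟨by omega, h.2.rowInsert_left x⟩
        · exact ⟨h.1, ih h.2 hy⟩

theorem insertLetter_perm (x : ℕ) (t : List (List ℕ)) :
    (insertLetter x t).flatten.Perm (x :: t.flatten) := by
  induction t generalizing x with
  | nil => simp [insertLetter]
  | cons r t ih =>
    have hp := rowInsert_perm x r
    simp only [insertLetter]
    split
    · next h =>
      rw [h] at hp
      simpa using hp.append_right t.flatten
    · next y h =>
      rw [h] at hp
      have h1 := (ih y).append_left (rowInsert x r).1
      have h2 := hp.append_right t.flatten
      simp only [Option.toList_some, List.append_assoc,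
        List.cons_append] at h2
      simpa using h1.trans h2

theorem insertLetter_ne_nil (x : ℕ) (t : List (List ℕ)) (ht : ∀ r ∈ t, r ≠ []) :
    ∀ r ∈ insertLetter x t, r ≠ [] := by
  induction t generalizing x with
  | nil => simp [insertLetter]
  | cons r t ih =>
    have h0 := rowInsert_ne_nil x r
    have ht' : ∀ r ∈ t, r ≠ [] := fun s hs => ht s (List.mem_cons_of_mem _ hs)
    simp only [insertLetter]
    split
    · intro s hs
      rcases List.mem_cons.1 hs with rfl | hs
      · exact h0
      · exact ht' s hs
    · next y _ =>
      intro s hs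
      rcases List.mem_cons.1 hs with rfl | hs
      · exact h0
      · exact ih y ht' s hs

theorem insertLetter_sorted (x : ℕ) (t : List (List ℕ)) (ht : ∀ r ∈ t, r.Pairwise (· ≤ ·)) :
    ∀ r ∈ insertLetter x t, r.Pairwise (· ≤ ·) := by
  induction t generalizing x with
  | nil => simp [insertLetter]
  | cons r t ih =>
    have h0 := rowInsert_sorted x r (ht r List.mem_cons_self)
    have ht' : ∀ r ∈ t, r.Pairwise (· ≤ ·) := fun s hs => ht s (List.mem_cons_of_mem _ hs)
    simp only [insertLetter]
    split
    · intro s hs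
      rcases List.mem_cons.1 hs with rfl | hs
      · exact h0
      · exact ht' s hs
    · next y _ =>
      intro s hs
      rcases List.mem_cons.1 hs with rfl | hs
      · exact h0
      · exact ih y ht' s hs

theorem insertLetter_head (x : ℕ) (s : List ℕ) (t : List (List ℕ)) :
    ∃ t', insertLetter x (s :: t) = (rowInsert x s).1 :: t' := by
  simp only [insertLetter]
  split <;> exact ⟨_, rfl⟩

theorem insertLetter_chain (x : ℕ) (t : List (List ℕ)) (ht : t.IsChain Below) :
    (insertLetter x t).IsChain Below := by
  induction t generalizing x with
  | nil => simp [insertLetter]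
  | cons r t ih =>
    simp only [insertLetter]
    split
    · cases t with
      | nil => simp
      | cons s t =>
        rw [List.isChain_cons_cons] at ht ⊢
        exact ⟨ht.1.rowInsert_left x, ht.2⟩
    · next y h =>
      cases t with
      | nil =>
        simp only [insertLetter, List.isChain_cons_cons, List.isChain_singleton, and_true]
        exact Below.rowInsert_both (s := []) (by cases r <;> simp [Below]) h
      | cons s t =>
        rw [List.isChain_cons_cons] at ht
        have h2 := ih y ht.2
        obtain ⟨t', ht'⟩ := insertLetter_head y s t
        rw [ht'] at h2 ⊢
        exact List.isChain_cons_cons.2 ⟨ht.1.rowInsert_both h, h2⟩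

theorem foldl_insertLetter (w : List ℕ) (t : List (List ℕ))
    (h1 : ∀ r ∈ t, r ≠ []) (h2 : ∀ r ∈ t, r.Pairwise (· ≤ ·)) (h3 : t.IsChain Below) :
    let s := w.foldl (fun t x => insertLetter x t) t
    (∀ r ∈ s, r ≠ []) ∧ (∀ r ∈ s, r.Pairwise (· ≤ ·)) ∧ s.IsChain Below ∧
      s.flatten.Perm (w ++ t.flatten) := by
  induction w generalizing t with
  | nil => exact ⟨h1, h2, h3, List.Perm.refl _⟩
  | cons x w ih =>
    obtain ⟨a, b, c, d⟩ := ih (insertLetter x t) (insertLetter_ne_nil x t h1)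
      (insertLetter_sorted x t h2) (insertLetter_chain x t h3)
    refine ⟨a, b, c, d.trans ?_⟩
    exact ((insertLetter_perm x t).append_left w).trans List.perm_middle

theorem schensted_spec (w : List ℕ) :
    (∀ r ∈ schensted w, r ≠ []) ∧ (∀ r ∈ schensted w, r.Pairwise (· ≤ ·)) ∧
      (schensted w).IsChain Below ∧ (schensted w).flatten.Perm w := by
  have h := foldl_insertLetter w [] (by simp) (by simp) (by simp)
  simp only [List.flatten_nil, List.append_nil] at h
  exact h

/-- The tableau `P(σ)` of a permutation in the Schensted correspondence. -/
def PermWord.P (σ : PermWord) : Tableau where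
  rows := schensted σ.word
  ne_nil := (schensted_spec σ.word).1
  row_lt := by
    obtain ⟨-, h2, -, h4⟩ := schensted_spec σ.word
    intro r hr
    have hd : r.Nodup := (List.nodup_flatten.1 (h4.nodup_iff.2 σ.nodup)).1 r hr
    exact ((h2 r hr).and hd).imp fun h => lt_of_le_of_ne h.1 h.2
  col_lt := (schensted_spec σ.word).2.2.1
  entries := by
    have h4 := (schensted_spec σ.word).2.2.2
    rw [h4.length_eq]
    exact h4.trans σ.isPerm

theorem PermWord.size_P (σ : PermWord) : σ.P.size = σ.word.length :=
  (schensted_spec σ.word).2.2.2.length_eq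

/-- The row reading word of a tableau: the rows are read from left to right, from the last (shortest)
one to the first one. It is the canonical permutation `σ` with `P(σ)` the given tableau. -/
def Tableau.reading (t : Tableau) : PermWord where
  word := t.rows.reverse.flatten
  isPerm := by
    have h : t.rows.reverse.flatten.Perm t.rows.flatten := (List.reverse_perm t.rows).flatten
    rw [h.length_eq]
    exact h.trans t.entries

theorem Tableau.length_reading (t : Tableau) : t.reading.word.length = t.size :=
  ((List.reverse_perm t.rows).flatten).length_eq

/-- Taskin's weak order on tableaux: the transitive closure of the relation holding between `U` and `V`
when `U = P(u)`, `V = P(v)` for some permutations `u ≤ v`. -/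
def Tableau.WeakLE : Tableau → Tableau → Prop :=
  Relation.TransGen fun U V => ∃ u v : PermWord, u.P = U ∧ v.P = V ∧ u.WeakLE v

/-- The left shifted concatenation product `V △ U` of tableaux, induced by that of permutations:
`V △ U = P(v △ u)` where `P(v) = V`, `P(u) = U`. -/
def Tableau.tri (V U : Tableau) : Tableau := (V.reading.tri U.reading).P

/-! ### Finiteness of the sets over which sums are taken -/

theorem finite_size (n : ℕ) : {t : Tableau | t.size = n}.Finite := by
  let f : {t : Tableau | t.size = n} → {l // l ∈ (List.range' 1 n).permutations} × Composition n :=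
    fun t => (⟨t.1.rows.flatten, by
        rw [List.mem_permutations]
        have h := t.1.entries
        have h2 : t.1.rows.flatten.length = n := t.2
        rwa [h2] at h⟩,
      ⟨t.1.rows.map List.length, by
        intro i hi
        obtain ⟨r, hr, rfl⟩ := List.mem_map.1 hi
        exact List.length_pos_iff.2 (t.1.ne_nil r hr), by
        have h2 : t.1.rows.flatten.length = n := t.2
        rwa [List.length_flatten] at h2⟩)
  have hf : Function.Injective f := by
    intro s t h
    simp only [f, Prod.mk.injEq, Subtype.mk.injEq, Composition.mk.injEq] at h
    apply Subtype.ext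
    apply Tableau.ext
    exact List.eq_iff_flatten_eq.2 h
  have : Finite {l // l ∈ (List.range' 1 n).permutations} :=
    (List.finite_toSet _).to_subtype
  have := Finite.of_injective f hf
  exact Set.toFinite _

theorem Tableau.WeakLE.size_eq {U V : Tableau} (h : U.WeakLE V) : V.size = U.size := by
  have key : ∀ {A B : Tableau},
      (∃ u v : PermWord, u.P = A ∧ v.P = B ∧ u.WeakLE v) → B.size = A.size := by
    rintro A B ⟨u, v, rfl, rfl, huv⟩
    rw [PermWord.size_P, PermWord.size_P, huv.1]
  induction h with
  | single h => exact key h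
  | tail _ h ih => exact (key h).trans ih

theorem Tableau.size_tri (V U : Tableau) : (V.tri U).size = V.size + U.size := by
  simp [Tableau.tri, PermWord.size_P, PermWord.tri, Tableau.length_reading]

theorem finite_above (t : Tableau) : {W : Tableau | t.WeakLE W}.Finite :=
  (finite_size t.size).subset fun _ h => h.size_eq

theorem finite_factorizations (t : Tableau) :
    {x : Tableau × Tableau | x.2.tri x.1 = t}.Finite := by
  have hf : {s : Tableau | s.size ≤ t.size}.Finite := by
    refine ((Set.finite_Iic t.size).biUnion fun n _ => finite_size n).subset fun s hs => ?_
    exact Set.mem_biUnion (show s.size ∈ Set.Iic t.size from hs) rfl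
  refine (hf.prod hf).subset ?_
  rintro ⟨U, V⟩ h
  have hs : (V.tri U).size = t.size := congrArg Tableau.size h
  rw [Tableau.size_tri] at hs
  exact ⟨show U.size ≤ t.size by omega, show V.size ≤ t.size by omega⟩

/-- The finite set of the tableaux `W ≥ t` for the weak order. -/
noncomputable def Tableau.above (t : Tableau) : Finset Tableau :=
  (finite_above t).toFinset

/-- The finite set of the pairs `(U, V)` of tableaux such that `t = V △ U`. -/
noncomputable def Tableau.factorizations (t : Tableau) : Finset (Tableau × Tableau) :=
  (finite_factorizations t).toFinset

/-! ### The coalgebras of permutations and of tableaux -/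

/-- The free `ℤ`-module on the set of all permutations. -/
abbrev ZS : Type := PermWord →₀ ℤ

/-- The free `ℤ`-module on the set of all standard Young tableaux. -/
abbrev ZT : Type := Tableau →₀ ℤ

/-- A permutation, as a basis element of `ℤS`. -/
noncomputable def PermWord.toZS (σ : PermWord) : ZS := Finsupp.single σ 1

/-- A tableau, as a basis element of `ℤT`. -/
noncomputable def Tableau.toZT (t : Tableau) : ZT := Finsupp.single t 1

/-- The linear map `ℤS → ℤT` sending each permutation `σ` to `P(σ)`. -/
noncomputable def linP : ZS →ₗ[ℤ] ZT :=
  Finsupp.linearCombination ℤ fun σ : PermWord => σ.P.toZT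

/-- The coproduct of `ℤS` (standardized unshuffling):
`δ(σ) = ∑_{0 ≤ i ≤ n} σ ∣ {1, …, i} ⊗ st(σ ∣ {i+1, …, n})`. -/
noncomputable def deltaS : ZS →ₗ[ℤ] ZS ⊗[ℤ] ZS :=
  Finsupp.linearCombination ℤ fun σ : PermWord =>
    ∑ i ∈ Finset.range (σ.word.length + 1), (σ.lower i).toZS ⊗ₜ[ℤ] (σ.upper i).toZS

/-- The coproduct of `ℤT`, the quotient of that of `ℤS` along `σ ↦ P(σ)`: it sends the tableau
`t = P(σ)` to the image of `δ(σ)` under `P ⊗ P`. -/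
noncomputable def deltaT : ZT →ₗ[ℤ] ZT ⊗[ℤ] ZT :=
  Finsupp.linearCombination ℤ fun t : Tableau =>
    TensorProduct.map linP linP (deltaS t.reading.toZS)

/-- `M` satisfies the identities `t = ∑_{t ≤ W} M_W` in `ℤT`, for all tableaux `t`, which define the
monomial basis. -/
def IsMonomial (M : Tableau → ZT) : Prop :=
  ∀ t : Tableau, t.toZT = ∑ W ∈ t.above, M W

end TableauHopf

/-! Both sides of the coproduct formula are functions of $\Sigma$, and such functions are equal as
soon as their sums over all $W\ge\Sigma$ are equal (Möbius inversion). Summing the left side gives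
$\delta(\Sigma)=\sum_i L_i\otimes R_i$, where $L_i$ and $R_i$ are the restrictions of $\Sigma$ to
the letters $\le i$ and $>i$; expanding both factors in the monomial basis gives $\mathcal
M_U\otimes\mathcal M_V$ over all $i$, $U\ge L_i$, $V\ge R_i$. Summing the right side gives the same
terms over the pairs with $\Sigma\le V\bigtriangleup U$. So everything rests on the equivalence
`Tableau.weakLE_tri_iff`: $\Sigma\le V\bigtriangleup U$ iff $L_i\le U$ and $R_i\le V$ for some $i$,
which must be $|U|$. It holds because restriction and $\bigtriangleup$ are monotone, restriction
recovers $U$ and $V$ from $V\bigtriangleup U$, and $\Sigma\le R_i\bigtriangleup L_i$.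

Two facts support this. By `PermWord.P_eq_iff`, $P(\sigma)=P(\tau)$ iff $\sigma,\tau$ are Knuth
equivalent, so operations on words compatible with Knuth moves descend to tableaux. And Taskin's
order is antisymmetric, without which Möbius inversion would fail. Both come from Greene's theorem:
the number of entries $\le j$ in the first $k$ rows is the largest total size of $k$ disjoint
increasing subwords among the letters $\le j$. These numbers are Knuth invariant, decrease weakly
along the weak order, and determine the tableau. -/

namespace TableauHopf

/-! ### Knuth equivalence -/

/-- The elementary Knuth transformations of words. -/
inductive KnuthMove : List ℕ → List ℕ → Prop
  | bac (x y : List ℕ) {a b c : ℕ} (h₁ : a < b) (h₂ : b < c) :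
      KnuthMove (x ++ b :: a :: c :: y) (x ++ b :: c :: a :: y)
  | acb (x y : List ℕ) {a b c : ℕ} (h₁ : a < b) (h₂ : b < c) :
      KnuthMove (x ++ a :: c :: b :: y) (x ++ c :: a :: b :: y)

/-- Knuth (plactic) equivalence of words. -/
def Knuth : List ℕ → List ℕ → Prop := Relation.EqvGen KnuthMove

theorem KnuthMove.perm {u v : List ℕ} (h : KnuthMove u v) : u.Perm v := by
  cases h with
  | bac x y h₁ h₂ => exact ((List.Perm.swap _ _ _).cons _).append_left x
  | acb x y h₁ h₂ => exact (List.Perm.swap _ _ _).append_left x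

namespace Knuth

theorem refl (u : List ℕ) : Knuth u u := Relation.EqvGen.refl u

theorem symm {u v : List ℕ} (h : Knuth u v) : Knuth v u := Relation.EqvGen.symm _ _ h

theorem trans {u v w : List ℕ} (h : Knuth u v) (h' : Knuth v w) : Knuth u w :=
  Relation.EqvGen.trans _ _ _ h h'

theorem of_move {u v : List ℕ} (h : KnuthMove u v) : Knuth u v := Relation.EqvGen.rel _ _ h

theorem perm {u v : List ℕ} (h : Knuth u v) : u.Perm v := by
  induction h with
  | rel _ _ h => exact h.perm
  | refl => exact List.Perm.refl _
  | symm _ _ _ ih => exact ih.symm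
  | trans _ _ _ _ _ ih₁ ih₂ => exact ih₁.trans ih₂

theorem append_left {u v : List ℕ} (h : Knuth u v) (w : List ℕ) : Knuth (w ++ u) (w ++ v) := by
  induction h with
  | rel _ _ h =>
    apply of_move
    cases h with
    | bac x y h₁ h₂ => simpa using KnuthMove.bac (w ++ x) y h₁ h₂
    | acb x y h₁ h₂ => simpa using KnuthMove.acb (w ++ x) y h₁ h₂
  | refl => exact refl _
  | symm _ _ _ ih => exact ih.symm
  | trans _ _ _ _ _ ih₁ ih₂ => exact ih₁.trans ih₂

theorem cons {u v : List ℕ} (h : Knuth u v) (a : ℕ) : Knuth (a :: u) (a :: v) :=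
  h.append_left [a]

theorem append_right {u v : List ℕ} (h : Knuth u v) (w : List ℕ) : Knuth (u ++ w) (v ++ w) := by
  induction h with
  | rel _ _ h =>
    apply of_move
    cases h with
    | bac x y h₁ h₂ => simpa using KnuthMove.bac x (y ++ w) h₁ h₂
    | acb x y h₁ h₂ => simpa using KnuthMove.acb x (y ++ w) h₁ h₂
  | refl => exact refl _
  | symm _ _ _ ih => exact ih.symm
  | trans _ _ _ _ _ ih₁ ih₂ => exact ih₁.trans ih₂

theorem append {u v u' v' : List ℕ} (h : Knuth u v) (h' : Knuth u' v') :
    Knuth (u ++ u') (v ++ v') :=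
  (h.append_right u').trans (h'.append_left v)

/-- Monotonicity is asked only on the letters of `u`: the truncated subtraction used in
standardization is not strictly monotone elsewhere. -/
theorem map {u v : List ℕ} (h : Knuth u v) (f : ℕ → ℕ) (hf : StrictMonoOn f {x | x ∈ u}) :
    Knuth (u.map f) (v.map f) := by
  induction h with
  | rel _ _ h =>
    apply of_move
    cases h with
    | bac x y h₁ h₂ =>
      simpa using KnuthMove.bac (x.map f) (y.map f) (hf (by simp) (by simp) h₁)
        (hf (by simp) (by simp) h₂)
    | acb x y h₁ h₂ =>
      simpa using KnuthMove.acb (x.map f) (y.map f) (hf (by simp) (by simp) h₁)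
        (hf (by simp) (by simp) h₂)
  | refl => exact refl _
  | symm _ _ h ih => exact (ih (by simpa [Knuth.perm h |>.mem_iff] using hf)).symm
  | trans _ _ _ h _ ih₁ ih₂ =>
    exact (ih₁ hf).trans (ih₂ (by simpa [Knuth.perm h |>.mem_iff] using hf))

/-- A move exchanges `a` and `c` next to the witness `b`. If `a` or `c` is erased, the two words
become equal; if both stay, convexity of `p` keeps `b`, and the move survives. -/
theorem filter {u v : List ℕ} (h : Knuth u v) (p : ℕ → Bool)
    (hp : ∀ a b c, a < b → b < c → p a → p c → p b) : Knuth (u.filter p) (v.filter p) := by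
  induction h with
  | rel _ _ h =>
    cases h with
    | @bac x y a b c h₁ h₂ =>
      have := hp a b c h₁ h₂
      by_cases ha : p a <;> by_cases hc : p c
      · have := of_move (KnuthMove.bac (x.filter p) (y.filter p) h₁ h₂)
        simp_all
      all_goals simp [List.filter_cons, ha, hc, refl]
    | @acb x y a b c h₁ h₂ =>
      have := hp a b c h₁ h₂
      by_cases ha : p a <;> by_cases hc : p c
      · have := of_move (KnuthMove.acb (x.filter p) (y.filter p) h₁ h₂)
        simp_all
      all_goals simp [List.filter_cons, ha, hc, refl]
  | refl => exact refl _
  | symm _ _ _ ih => exact ih.symm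
  | trans _ _ _ _ _ ih₁ ih₂ => exact ih₁.trans ih₂

end Knuth

/-! ### Insertion and Knuth equivalence -/

/-- The letter `x` travels left through `r`; at each step the letter before the exchanged pair lies
between the two and serves as witness. -/
theorem knuth_append_singleton_of_lt {a x : ℕ} {r : List ℕ} (hr : (a :: r).Pairwise (· < ·))
    (hx : x < a) : Knuth (a :: (r ++ [x])) (a :: x :: r) := by
  induction r generalizing a with
  | nil => exact Knuth.refl _
  | cons c r ih =>
    have hac : a < c := List.rel_of_pairwise_cons hr (by simp)
    refine ((ih (List.Pairwise.of_cons hr) (hx.trans hac)).cons a).trans ?_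
    exact (Knuth.of_move (KnuthMove.bac [] r hx hac)).symm

theorem exists_rowInsert_eq_cons (x : ℕ) (r : List ℕ) :
    ∃ d s, (rowInsert x r).1 = d :: s ∧ d ≤ x ∧ (d = x ∨ d ∈ r) := by
  cases r with
  | nil => exact ⟨x, [], rfl, le_rfl, Or.inl rfl⟩
  | cons a r =>
    simp only [rowInsert]
    split_ifs with h
    · exact ⟨x, r, rfl, le_rfl, Or.inl rfl⟩
    · exact ⟨a, _, rfl, not_lt.1 h, Or.inr (by simp)⟩

/-- Bumping within a row is a chain of Knuth moves. The bumped letter `y` must pass the letter `a`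
to its left; the head `d` of the new remainder of the row is the witness, as `a < d ≤ x < y`. -/
theorem knuth_rowInsert {x : ℕ} {r : List ℕ} (hr : r.Pairwise (· < ·)) (hx : x ∉ r) :
    Knuth (r ++ [x]) ((rowInsert x r).2.toList ++ (rowInsert x r).1) := by
  induction r with
  | nil => exact Knuth.refl _
  | cons a r ih =>
    rw [List.mem_cons, not_or] at hx
    simp only [rowInsert]
    split_ifs with h
    · exact knuth_append_singleton_of_lt hr h
    · have hax : a < x := by omega
      have ih' := (ih hr.of_cons hx.2).cons a
      cases hy : (rowInsert x r).2 with
      | none => simpa [hy] using ih'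
      | some y =>
        have hxy := rowInsert_lt hy
        obtain ⟨d, s, hs, hdx, hd⟩ := exists_rowInsert_eq_cons x r
        have had : a < d := by
          rcases hd with rfl | hd
          · exact hax
          · exact List.rel_of_pairwise_cons hr hd
        rw [hy, hs] at ih'
        rw [hs]
        exact ih'.trans (Knuth.of_move (KnuthMove.acb [] s had (by omega)))

/-- The row reading word of an array of rows. -/
def readingWord (t : List (List ℕ)) : List ℕ := t.reverse.flatten

@[simp] theorem readingWord_nil : readingWord [] = [] := rfl

@[simp] theorem readingWord_cons (r : List ℕ) (t : List (List ℕ)) :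
    readingWord (r :: t) = readingWord t ++ r := by simp [readingWord]

theorem readingWord_perm (t : List (List ℕ)) : (readingWord t).Perm t.flatten :=
  (List.reverse_perm t).flatten

/-- The letter bumped from a row lands right after the reading word of the rows below, ready to be
inserted there. -/
theorem knuth_insertLetter {x : ℕ} {t : List (List ℕ)} (ht : ∀ r ∈ t, r.Pairwise (· < ·))
    (hx : (x :: t.flatten).Nodup) :
    Knuth (readingWord t ++ [x]) (readingWord (insertLetter x t)) := by
  induction t generalizing x with
  | nil => exact Knuth.refl _
  | cons r t ih =>
    have hxr : x ∉ r := by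
      intro h
      exact (List.nodup_cons.1 hx).1 (by simp [h])
    have hrow := knuth_rowInsert (ht r (by simp)) hxr
    have hp := rowInsert_perm x r
    rw [readingWord_cons, List.append_assoc]
    refine (hrow.append_left _).trans ?_
    simp only [insertLetter]
    split
    · next h => simpa [h] using Knuth.refl _
    · next y h =>
      rw [h] at hp
      have hnd : (y :: t.flatten).Nodup := by
        have h2 := (hp.append_right t.flatten).nodup_iff.2 (by simpa using hx)
        simp only [Option.toList_some, List.append_assoc, List.cons_append,
          List.nil_append] at h2
        exact (List.nodup_append.1 h2).2.1
      have := (ih (fun s hs => ht s (by simp [hs])) hnd).append_right (rowInsert x r).1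
      simpa [h] using this

theorem schensted_pairwise {w : List ℕ} (hw : w.Nodup) :
    ∀ r ∈ schensted w, r.Pairwise (· < ·) := by
  obtain ⟨-, h2, -, h4⟩ := schensted_spec w
  intro r hr
  have hd : r.Nodup := (List.nodup_flatten.1 (h4.nodup_iff.2 hw)).1 r hr
  exact ((h2 r hr).and hd).imp fun h => lt_of_le_of_ne h.1 h.2

theorem knuth_schensted {w : List ℕ} (hw : w.Nodup) : Knuth w (readingWord (schensted w)) := by
  induction w using List.reverseRecOn with
  | nil => exact Knuth.refl _
  | append_singleton w x ih =>
    have hw' := (List.nodup_append.1 hw).1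
    have h : schensted (w ++ [x]) = insertLetter x (schensted w) := by simp [schensted]
    rw [h]
    refine ((ih hw').append_right [x]).trans (knuth_insertLetter (schensted_pairwise hw') ?_)
    exact (((schensted_spec w).2.2.2.cons x).nodup_iff).2
      ((List.perm_append_singleton x w).nodup_iff.1 hw)

/-! ### Unions of increasing subsequences -/

/-- `f` colours some letters of `w` with the colours `0, …, k - 1` (the letters with `k ≤ f x` are not
coloured) in such a way that the letters of each colour form an increasing subword. -/
def IsIncColoring (f : ℕ → ℕ) (k : ℕ) (w : List ℕ) : Prop :=
  w.Pairwise fun a b => f a = f b → f a < k → a < b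

/-- The word `w` contains `k` disjoint increasing subwords, with at least `m` letters in total. -/
def HasInc (w : List ℕ) (k m : ℕ) : Prop :=
  ∃ f : ℕ → ℕ, IsIncColoring f k w ∧ m ≤ w.countP fun x => f x < k

/-- The same colouring works: a descending pair of one colour in `u` would be an inversion of `u`,
hence of `v`. -/
theorem HasInc.of_inversions {u v : List ℕ} {k m : ℕ} (h : HasInc v k m) (hp : u.Perm v)
    (hu : u.Nodup) (hi : inversions u ⊆ inversions v) : HasInc u k m := by
  obtain ⟨f, hf, hm⟩ := h
  refine ⟨f, ?_, by rwa [hp.countP_eq]⟩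
  refine List.pairwise_iff_forall_sublist.2 fun {a b} hab hfab hfk => ?_
  by_contra hlt
  have hne : a ≠ b := by
    have := hab.nodup hu
    simpa using this
  have : (a, b) ∈ inversions v := hi ⟨by simp only; omega, hab⟩
  exact hlt (List.pairwise_iff_forall_sublist.1 hf this.2 hfab hfk)

theorem isIncColoring_append_three {f : ℕ → ℕ} {k : ℕ} {x y : List ℕ} {p q r : ℕ} :
    IsIncColoring f k (x ++ p :: q :: r :: y) ↔
      IsIncColoring f k x ∧ IsIncColoring f k y ∧
      (∀ z ∈ x, ∀ t ∈ y, f z = f t → f z < k → z < t) ∧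
      (∀ z ∈ x, (f z = f p → f z < k → z < p) ∧ (f z = f q → f z < k → z < q) ∧
        (f z = f r → f z < k → z < r)) ∧
      (∀ t ∈ y, (f p = f t → f p < k → p < t) ∧ (f q = f t → f q < k → q < t) ∧
        (f r = f t → f r < k → r < t)) ∧
      (f p = f q → f p < k → p < q) ∧ (f p = f r → f p < k → p < r) ∧
      (f q = f r → f q < k → q < r) := by
  simp only [IsIncColoring, List.pairwise_append, List.pairwise_cons, List.mem_cons, or_imp,
    forall_and, forall_eq]
  tauto

theorem IsIncColoring.congr {f g : ℕ → ℕ} {k : ℕ} {w : List ℕ} (h : IsIncColoring f k w)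
    (hg : ∀ a ∈ w, ∀ b ∈ w, g a = g b → g a < k → f a = f b ∧ f a < k) : IsIncColoring g k w :=
  List.Pairwise.imp_of_mem (fun ha hb h hab hk =>
    h (hg _ ha _ hb hab hk).1 (hg _ ha _ hb hab hk).2) h

/-- Exchanging `a` and `c` only hurts a subword that contains both. That subword is repaired with
the help of `b`, without changing the number of subwords or losing letters. -/
theorem HasInc.bac {x y : List ℕ} {a b c k m : ℕ} (h₁ : a < b) (h₂ : b < c)
    (hn : (x ++ b :: a :: c :: y).Nodup) (h : HasInc (x ++ b :: a :: c :: y) k m) :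
    HasInc (x ++ b :: c :: a :: y) k m := by
  obtain ⟨f, hf, hm⟩ := h
  simp only [List.nodup_append, List.nodup_cons, List.mem_cons, not_or] at hn
  obtain ⟨hnx, ⟨⟨-, -, hby⟩, ⟨-, hay⟩, hcy, hny⟩, hnxy⟩ := hn
  have hxa : a ∉ x := fun h => hnxy a h a (by simp) rfl
  have hxb : b ∉ x := fun h => hnxy b h b (by simp) rfl
  have hxc : c ∉ x := fun h => hnxy c h c (by simp) rfl
  have hxy : ∀ z ∈ x, z ∉ y := fun z h h' => hnxy z h z (by simp [h']) rfl
  obtain ⟨hx, hy, hxy', hx3, hy3, hba, hbc, hac⟩ := isIncColoring_append_three.1 hf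
  by_cases hfac : f a = f c ∧ f a < k
  · obtain ⟨hfac, hak⟩ := hfac
    have hne : f b ≠ f a := fun h => absurd (hba h (h ▸ hak)) (by omega)
    by_cases hb : f b < k
    · let g : ℕ → ℕ := fun z => if z ∈ x ∨ z = a ∨ z = b then f z else
        if f z = f a then f b else if f z = f b then f a else f z
      have hgx : ∀ z ∈ x, g z = f z := fun z hz => by simp [g, hz]
      have hga : g a = f a := by simp [g]
      have hgb : g b = f b := by simp [g]
      have hgc : g c = f b := by
        simp only [g]
        rw [if_neg (by simp [hxc]; omega), if_pos hfac.symm]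
      have hgy : ∀ z ∈ y, g z = if f z = f a then f b else if f z = f b then f a else f z := by
        intro z hz
        simp only [g]
        rw [if_neg]
        rintro (h | rfl | rfl)
        · exact hxy z h hz
        · exact hay hz
        · exact hby hz
      refine ⟨g, isIncColoring_append_three.2 ⟨?_, ?_, ?_, ?_, ?_, ?_, ?_, ?_⟩, ?_⟩
      · exact hx.congr fun p hp q hq => by rw [hgx p hp, hgx q hq]; exact fun h h' => ⟨h, h'⟩
      · refine hy.congr fun p hp q hq => ?_
        rw [hgy p hp, hgy q hq]
        grind
      · intro z hz t ht
        rw [hgx z hz, hgy t ht]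
        have := hx3 z hz
        have := hy3 t ht
        have := hxy' z hz t ht
        grind
      · intro z hz
        rw [hgx z hz, hga, hgb, hgc]
        have := hx3 z hz
        grind
      · intro t ht
        rw [hgy t ht, hga, hgb, hgc]
        have := hy3 t ht
        grind
      · omega
      · omega
      · omega
      · rw [← (KnuthMove.bac x y h₁ h₂).perm.countP_eq]
        refine hm.trans (List.countP_mono_left fun z _ hz => ?_)
        simp only [decide_eq_true_eq, g] at hz ⊢
        split_ifs <;> omega
    · let g : ℕ → ℕ := fun z => if z = a then f b else if z = b then f a else f z
      have hga : g a = f b := by simp [g]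
      have hgb : g b = f a := by simp only [g]; rw [if_neg (by omega), if_pos trivial]
      have hgo : ∀ z, z ≠ a → z ≠ b → g z = f z := fun z h h' => by simp [g, h, h']
      have hgc : g c = f c := hgo c (by omega) (by omega)
      have hgx : ∀ z ∈ x, g z = f z := fun z hz =>
        hgo z (fun h => hxa (h ▸ hz)) (fun h => hxb (h ▸ hz))
      have hgy : ∀ z ∈ y, g z = f z := fun z hz =>
        hgo z (fun h => hay (h ▸ hz)) (fun h => hby (h ▸ hz))
      refine ⟨g, isIncColoring_append_three.2 ⟨?_, ?_, ?_, ?_, ?_, ?_, ?_, ?_⟩, ?_⟩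
      · exact hx.congr fun p hp q hq => by rw [hgx p hp, hgx q hq]; exact fun h h' => ⟨h, h'⟩
      · exact hy.congr fun p hp q hq => by rw [hgy p hp, hgy q hq]; exact fun h h' => ⟨h, h'⟩
      · intro z hz t ht
        rw [hgx z hz, hgy t ht]
        exact hxy' z hz t ht
      · intro z hz
        rw [hgx z hz, hga, hgb, hgc]
        have := hx3 z hz
        grind
      · intro t ht
        rw [hgy t ht, hga, hgb, hgc]
        have := hy3 t ht
        grind
      · omega
      · omega
      · omega
      · rw [← (KnuthMove.bac x y h₁ h₂).perm.countP_eq]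
        simp only [List.countP_append, List.countP_cons] at hm ⊢
        rw [List.countP_congr (l := x) (fun z hz => by rw [hgx z hz]),
          List.countP_congr (l := y) (fun z hz => by rw [hgy z hz]), hga, hgb, hgc]
        omega
  -- The only new constraint, on the pair `c`, `a`, is void for `f`.
  · refine ⟨f, isIncColoring_append_three.2 ⟨hx, hy, hxy', ?_, ?_, ?_, ?_, ?_⟩, ?_⟩
    · exact fun z hz => ⟨(hx3 z hz).1, (hx3 z hz).2.2, (hx3 z hz).2.1⟩
    · exact fun z hz => ⟨(hy3 z hz).1, (hy3 z hz).2.2, (hy3 z hz).2.1⟩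
    · exact hbc
    · exact hba
    · intro h h'
      exact absurd ⟨h.symm, h ▸ h'⟩ hfac
    · rwa [← (KnuthMove.bac x y h₁ h₂).perm.countP_eq]

/-- Same repair as for the other move, with the roles of `a` and `c` reversed. -/
theorem HasInc.acb {x y : List ℕ} {a b c k m : ℕ} (h₁ : a < b) (h₂ : b < c)
    (hn : (x ++ a :: c :: b :: y).Nodup) (h : HasInc (x ++ a :: c :: b :: y) k m) :
    HasInc (x ++ c :: a :: b :: y) k m := by
  obtain ⟨f, hf, hm⟩ := h
  simp only [List.nodup_append, List.nodup_cons, List.mem_cons, not_or] at hn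
  obtain ⟨hnx, ⟨⟨-, -, hay⟩, ⟨-, hcy⟩, hby, hny⟩, hnxy⟩ := hn
  have hxa : a ∉ x := fun h => hnxy a h a (by simp) rfl
  have hxb : b ∉ x := fun h => hnxy b h b (by simp) rfl
  have hxc : c ∉ x := fun h => hnxy c h c (by simp) rfl
  have hxy : ∀ z ∈ x, z ∉ y := fun z h h' => hnxy z h z (by simp [h']) rfl
  obtain ⟨hx, hy, hxy', hx3, hy3, hac, hab, hcb⟩ := isIncColoring_append_three.1 hf
  by_cases hfac : f a = f c ∧ f a < k
  · obtain ⟨hfac, hak⟩ := hfac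
    have hne : f b ≠ f a := fun h => absurd (hcb (by omega) (by omega)) (by omega)
    by_cases hb : f b < k
    -- Tails are exchanged again: `… a c …` and `… b …` become `… a b` with the old tail of `b`, and
    -- the old beginning of the subword of `b` followed by `c …`.
    · let g : ℕ → ℕ := fun z => if z ∈ x ∨ z = a then f z else
        if f z = f a then f b else if f z = f b then f a else f z
      have hgx : ∀ z ∈ x, g z = f z := fun z hz => by simp [g, hz]
      have hga : g a = f a := by simp [g]
      have hgb : g b = f a := by
        simp only [g]
        rw [if_neg (by simp [hxb]; omega), if_neg hne, if_pos trivial]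
      have hgc : g c = f b := by
        simp only [g]
        rw [if_neg (by simp [hxc]; omega), if_pos hfac.symm]
      have hgy : ∀ z ∈ y, g z = if f z = f a then f b else if f z = f b then f a else f z := by
        intro z hz
        simp only [g]
        rw [if_neg]
        rintro (h | rfl)
        · exact hxy z h hz
        · exact hay hz
      refine ⟨g, isIncColoring_append_three.2 ⟨?_, ?_, ?_, ?_, ?_, ?_, ?_, ?_⟩, ?_⟩
      · exact hx.congr fun p hp q hq => by rw [hgx p hp, hgx q hq]; exact fun h h' => ⟨h, h'⟩
      · refine hy.congr fun p hp q hq => ?_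
        rw [hgy p hp, hgy q hq]
        grind
      · intro z hz t ht
        rw [hgx z hz, hgy t ht]
        have := hx3 z hz
        have := hy3 t ht
        have := hxy' z hz t ht
        grind
      · intro z hz
        rw [hgx z hz, hga, hgb, hgc]
        have := hx3 z hz
        grind
      · intro t ht
        rw [hgy t ht, hga, hgb, hgc]
        have := hy3 t ht
        grind
      · omega
      · omega
      · omega
      · rw [← (KnuthMove.acb x y h₁ h₂).perm.countP_eq]
        refine hm.trans (List.countP_mono_left fun z _ hz => ?_)
        simp only [decide_eq_true_eq, g] at hz ⊢
        split_ifs <;> omega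
    -- The uncoloured letter `b` replaces `c`: `… a c …` becomes `… a b …`.
    · let g : ℕ → ℕ := fun z => if z = c then f b else if z = b then f a else f z
      have hgc : g c = f b := by simp [g]
      have hgb : g b = f a := by simp only [g]; rw [if_neg (by omega), if_pos trivial]
      have hgo : ∀ z, z ≠ c → z ≠ b → g z = f z := fun z h h' => by simp [g, h, h']
      have hga : g a = f a := hgo a (by omega) (by omega)
      have hgx : ∀ z ∈ x, g z = f z := fun z hz =>
        hgo z (fun h => hxc (h ▸ hz)) (fun h => hxb (h ▸ hz))
      have hgy : ∀ z ∈ y, g z = f z := fun z hz =>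
        hgo z (fun h => hcy (h ▸ hz)) (fun h => hby (h ▸ hz))
      refine ⟨g, isIncColoring_append_three.2 ⟨?_, ?_, ?_, ?_, ?_, ?_, ?_, ?_⟩, ?_⟩
      · exact hx.congr fun p hp q hq => by rw [hgx p hp, hgx q hq]; exact fun h h' => ⟨h, h'⟩
      · exact hy.congr fun p hp q hq => by rw [hgy p hp, hgy q hq]; exact fun h h' => ⟨h, h'⟩
      · intro z hz t ht
        rw [hgx z hz, hgy t ht]
        exact hxy' z hz t ht
      · intro z hz
        rw [hgx z hz, hga, hgb, hgc]
        have := hx3 z hz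
        grind
      · intro t ht
        rw [hgy t ht, hga, hgb, hgc]
        have := hy3 t ht
        grind
      · omega
      · omega
      · omega
      · rw [← (KnuthMove.acb x y h₁ h₂).perm.countP_eq]
        simp only [List.countP_append, List.countP_cons] at hm ⊢
        rw [List.countP_congr (l := x) (fun z hz => by rw [hgx z hz]),
          List.countP_congr (l := y) (fun z hz => by rw [hgy z hz]), hga, hgb, hgc]
        simp only [decide_eq_true_eq] at hm ⊢
        split_ifs at hm ⊢ <;> omega
  · refine ⟨f, isIncColoring_append_three.2 ⟨hx, hy, hxy', ?_, ?_, ?_, ?_, ?_⟩, ?_⟩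
    · exact fun z hz => ⟨(hx3 z hz).2.1, (hx3 z hz).1, (hx3 z hz).2.2⟩
    · exact fun z hz => ⟨(hy3 z hz).2.1, (hy3 z hz).1, (hy3 z hz).2.2⟩
    · intro h h'
      exact absurd ⟨h.symm, h ▸ h'⟩ hfac
    · exact hcb
    · exact hab
    · rwa [← (KnuthMove.acb x y h₁ h₂).perm.countP_eq]

/-- Sorting two adjacent letters does not destroy increasing subwords. -/
theorem HasInc.of_swap {x y : List ℕ} {p q k m : ℕ} (hpq : p < q)
    (h : HasInc (x ++ q :: p :: y) k m) : HasInc (x ++ p :: q :: y) k m := by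
  obtain ⟨f, hf, hm⟩ := h
  have hp : (x ++ q :: p :: y).Perm (x ++ p :: q :: y) := (List.Perm.swap _ _ _).append_left x
  refine ⟨f, ?_, by rwa [← hp.countP_eq]⟩
  simp only [IsIncColoring, List.pairwise_append, List.pairwise_cons, List.mem_cons, or_imp,
    forall_and, forall_eq] at hf ⊢
  tauto

/-- Backwards, both moves merely sort the adjacent letters `c`, `a`. -/
theorem KnuthMove.hasInc_iff {u v : List ℕ} (h : KnuthMove u v) (hu : u.Nodup) (k m : ℕ) :
    HasInc u k m ↔ HasInc v k m := by
  cases h with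
  | @bac x y a b c h₁ h₂ =>
    refine ⟨HasInc.bac h₁ h₂ hu, fun h => ?_⟩
    have := HasInc.of_swap (x := x ++ [b]) (h₁.trans h₂) (by simpa using h)
    simpa using this
  | acb x y h₁ h₂ => exact ⟨HasInc.acb h₁ h₂ hu, HasInc.of_swap (h₁.trans h₂)⟩

theorem Knuth.hasInc_iff {u v : List ℕ} (h : Knuth u v) (hu : u.Nodup) (k m : ℕ) :
    HasInc u k m ↔ HasInc v k m := by
  induction h with
  | rel _ _ h => exact h.hasInc_iff hu k m
  | refl => exact Iff.rfl
  | symm _ _ h ih => exact (ih ((Knuth.perm h).nodup_iff.2 hu)).symm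
  | trans _ _ _ h _ ih₁ ih₂ => exact (ih₁ hu).trans (ih₂ ((Knuth.perm h).nodup_iff.1 hu))

/-! ### Greene's theorem for row reading words -/

theorem Below.nil_left {s : List ℕ} (h : Below [] s) : s = [] := by
  cases s with
  | nil => rfl
  | cons => exact h.elim

theorem Below.tail {r s : List ℕ} (h : Below r s) : Below r.tail s.tail := by
  cases r <;> cases s <;> simp_all [Below]

theorem Below.filter_le {r s : List ℕ} (h : Below r s) (hs : s.Pairwise (· < ·)) (j : ℕ) :
    Below (r.filter (· ≤ j)) (s.filter (· ≤ j)) := by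
  induction r generalizing s with
  | nil => simp [h.nil_left, Below]
  | cons a r ih =>
    cases s with
    | nil => simp [Below]
    | cons b s =>
      by_cases hb : b ≤ j
      · have ha : a ≤ j := h.1.le.trans hb
        simpa [ha, hb, Below, h.1] using ih h.2 hs.of_cons
      · have : (b :: s).filter (· ≤ j) = [] := by
          rw [List.filter_eq_nil_iff]
          intro z hz
          rcases List.mem_cons.1 hz with rfl | hz
          · simpa using hb
          · have := List.rel_of_pairwise_cons hs hz
            simp only [decide_eq_true_eq]
            omega
        rw [this]
        simp [Below]

/-- The number of cells in the first `k` rows. -/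
def firstRows (t : List (List ℕ)) (k : ℕ) : ℕ := ((t.take k).map List.length).sum

/-- The first column of an array. -/
def firstColumn (t : List (List ℕ)) : List ℕ := t.filterMap List.head?

@[simp] theorem firstColumn_nil_cons (t : List (List ℕ)) :
    firstColumn ([] :: t) = firstColumn t := rfl

@[simp] theorem firstColumn_cons_cons (a : ℕ) (r : List ℕ) (t : List (List ℕ)) :
    firstColumn ((a :: r) :: t) = a :: firstColumn t := rfl

/-- Restricting letters or deleting columns leaves empty rows in the array; they can only be at the
end. -/
theorem firstColumn_eq_nil {t : List (List ℕ)} (ht : ([] :: t).IsChain Below) :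
    firstColumn t = [] := by
  induction t with
  | nil => rfl
  | cons s t ih =>
    rw [List.isChain_cons_cons] at ht
    obtain rfl := ht.1.nil_left
    exact ih ht.2

theorem firstColumn_pairwise {t : List (List ℕ)} (ht : t.IsChain Below) :
    (firstColumn t).Pairwise (· < ·) := by
  rw [← List.isChain_iff_pairwise]
  induction t with
  | nil => exact List.IsChain.nil
  | cons r t ih =>
    cases r with
    | nil => simpa using ih ht.tail
    | cons a r =>
      cases t with
      | nil => simp [firstColumn]
      | cons s t =>
        rw [List.isChain_cons_cons] at ht
        cases s with
        | nil => simp [firstColumn_eq_nil ht.2]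
        | cons b s => simpa [List.isChain_cons_cons, ht.1.1] using ih ht.2

/-- Each nonempty row loses one cell with the first column. Equality holds, but only this bound is
needed. -/
theorem length_take_firstColumn {t : List (List ℕ)} (ht : t.IsChain Below) (k : ℕ) :
    ((firstColumn t).take k).length + firstRows (t.map List.tail) k ≤ firstRows t k := by
  induction t generalizing k with
  | nil => simp [firstColumn, firstRows]
  | cons r t ih =>
    cases k with
    | zero => simp [firstRows]
    | succ k =>
      have := ih ht.tail k
      cases r with
      | nil =>
        rw [firstColumn_nil_cons, firstColumn_eq_nil ht] at *
        simp only [firstRows] at *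
        simpa using this
      | cons a r =>
        simp only [firstRows] at *
        simp only [firstColumn_cons_cons, List.map_cons, List.take_succ_cons, List.length_cons,
          List.tail_cons, List.sum_cons]
        omega

theorem reverse_firstColumn_sublist (t : List (List ℕ)) :
    (firstColumn t).reverse.Sublist (readingWord t) := by
  induction t with
  | nil => exact List.Sublist.refl _
  | cons r t ih =>
    cases r with
    | nil => simpa using ih
    | cons a r => simpa using ih.append (List.singleton_sublist.2 (List.mem_cons_self (l := r)))

theorem readingWord_map_tail_sublist (t : List (List ℕ)) :
    (readingWord (t.map List.tail)).Sublist (readingWord t) := by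
  induction t with
  | nil => exact List.Sublist.refl _
  | cons r t ih => simpa using ih.append (List.tail_sublist r)

theorem countP_readingWord (p : ℕ → Bool) (t : List (List ℕ)) :
    (readingWord t).countP p =
      (firstColumn t).countP p + (readingWord (t.map List.tail)).countP p := by
  induction t with
  | nil => rfl
  | cons r t ih =>
    cases r with
    | nil => simpa using ih
    | cons a r =>
      simp only [readingWord_cons, List.countP_append, ih, List.map_cons, firstColumn_cons_cons,
        List.countP_cons, List.tail_cons]
      omega

/-- The first column is read as a decreasing subword, so each of the `k` increasing subwords meets
it at most once. -/
theorem IsIncColoring.countP_firstColumn_le {f : ℕ → ℕ} {k : ℕ} {t : List (List ℕ)}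
    (ht : t.IsChain Below) (hf : IsIncColoring f k (readingWord t)) :
    (firstColumn t).countP (fun x => f x < k) ≤ ((firstColumn t).take k).length := by
  rw [List.length_take, le_min_iff]
  refine ⟨?_, List.countP_le_length⟩
  have h1 : IsIncColoring f k (firstColumn t).reverse := hf.sublist (reverse_firstColumn_sublist t)
  rw [IsIncColoring, List.pairwise_reverse] at h1
  have h2 := (h1.and (firstColumn_pairwise ht)).imp (S := fun a b => f a < k → f a ≠ f b)
    fun {a b} h hk hab => by
      have := h.1 hab.symm (hab ▸ hk)
      omega
  have h3 : (((firstColumn t).filter fun x => f x < k).map f).Nodup := by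
    rw [List.Nodup, List.pairwise_map]
    refine List.Pairwise.imp_of_mem (fun {a b} ha _ h => h ?_) (h2.filter _)
    simpa using (List.mem_filter.1 ha).2
  have h4 := (List.subperm_of_subset h3 (l₂ := List.range k) (by
    intro z hz
    obtain ⟨a, ha, rfl⟩ := List.mem_map.1 hz
    simpa using (List.mem_filter.1 ha).2)).length_le
  simpa [List.countP_eq_length_filter] using h4

/-- The columns are peeled off one by one. A column of height `h` has at most `min k h` coloured
letters, which is its number of cells in the first `k` rows. -/
theorem IsIncColoring.countP_le {f : ℕ → ℕ} {k : ℕ} {t : List (List ℕ)}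
    (ht : t.IsChain Below) (hf : IsIncColoring f k (readingWord t)) :
    (readingWord t).countP (fun x => f x < k) ≤ firstRows t k := by
  obtain ⟨n, hn⟩ : ∃ n, ∀ r ∈ t, r.length ≤ n :=
    ⟨(t.map List.length).sum, fun r hr => List.single_le_sum (by simp) _ (List.mem_map_of_mem hr)⟩
  induction n generalizing t with
  | zero =>
    have : readingWord t = [] := by
      simp only [readingWord, List.flatten_eq_nil_iff, List.mem_reverse]
      intro r hr
      simpa using hn r hr
    simp [this]
  | succ n ih =>
    have h1 := hf.countP_firstColumn_le ht
    have h2 := ih (t := t.map List.tail)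
      (List.isChain_map_of_isChain _ (fun _ _ h => Below.tail h) ht)
      (hf.sublist (readingWord_map_tail_sublist t)) (by
        intro r hr
        obtain ⟨s, hs, rfl⟩ := List.mem_map.1 hr
        have := hn s hs
        simp only [List.length_tail]
        omega)
    have h3 := length_take_firstColumn ht k
    rw [countP_readingWord]
    omega

/-- The first `k` rows themselves are disjoint increasing subwords. -/
theorem hasInc_firstRows {t : List (List ℕ)} (ht : ∀ r ∈ t, r.Pairwise (· < ·))
    (hn : t.flatten.Nodup) (k : ℕ) : HasInc (readingWord t) k (firstRows t k) := by
  induction t generalizing k with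
  | nil => exact ⟨id, by simp [IsIncColoring], by simp [firstRows]⟩
  | cons r t ih =>
    cases k with
    | zero =>
      exact ⟨id, List.pairwise_of_forall (fun _ _ _ h => absurd h (by simp)), by simp [firstRows]⟩
    | succ k =>
      rw [List.flatten_cons, List.nodup_append] at hn
      obtain ⟨f, hf, hm⟩ := ih (fun s hs => ht s (by simp [hs])) hn.2.1 k
      have hd : ∀ x ∈ readingWord t, x ∉ r := fun x hx hr =>
        hn.2.2 x hr x ((readingWord_perm t).mem_iff.1 hx) rfl
      refine ⟨fun x => if x ∈ r then 0 else f x + 1, ?_, ?_⟩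
      · rw [readingWord_cons, IsIncColoring, List.pairwise_append]
        refine ⟨?_, ?_, ?_⟩
        · refine List.Pairwise.imp_of_mem (fun {a b} ha hb h => ?_) hf
          simpa [hd a ha, hd b hb] using h
        · exact (ht r (by simp)).imp fun h _ _ => h
        · intro a ha b hb
          simp [hd a ha, hb]
      · rw [readingWord_cons, List.countP_append,
          List.countP_congr (l := readingWord t) (q := fun x => f x < k)
            (fun x hx => by simp [hd x hx]),
          List.countP_eq_length.2 (show ∀ x ∈ r, _ from fun x hx => by simp [hx])]
        simp only [firstRows, List.take_succ_cons, List.map_cons, List.sum_cons] at hm ⊢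
        omega

theorem HasInc.mono {w : List ℕ} {k m n : ℕ} (h : HasInc w k n) (hmn : m ≤ n) : HasInc w k m :=
  let ⟨f, hf, hn⟩ := h
  ⟨f, hf, hmn.trans hn⟩

/-- Greene's theorem for the row reading word of a tableau. -/
theorem hasInc_readingWord_iff {t : List (List ℕ)} (ht : ∀ r ∈ t, r.Pairwise (· < ·))
    (hc : t.IsChain Below) (hn : t.flatten.Nodup) (k m : ℕ) :
    HasInc (readingWord t) k m ↔ m ≤ firstRows t k :=
  ⟨fun ⟨_, hf, hm⟩ => hm.trans (hf.countP_le hc), (hasInc_firstRows ht hn k).mono⟩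

theorem readingWord_filter (p : ℕ → Bool) (t : List (List ℕ)) :
    (readingWord t).filter p = readingWord (t.map (List.filter p)) := by
  induction t with
  | nil => rfl
  | cons r t ih => simp [ih]

theorem isChain_map_filter {t : List (List ℕ)} (ht : ∀ r ∈ t, r.Pairwise (· < ·))
    (hc : t.IsChain Below) (j : ℕ) : (t.map (List.filter (· ≤ j))).IsChain Below := by
  induction t with
  | nil => simp
  | cons r t ih =>
    cases t with
    | nil => simp
    | cons s t =>
      rw [List.isChain_cons_cons] at hc
      simp only [List.map_cons, List.isChain_cons_cons]
      exact ⟨hc.1.filter_le (ht s (by simp)) j, ih (fun q hq => ht q (by simp [hq])) hc.2⟩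

/-- The number of entries `≤ j` in the first `k` rows of a tableau. -/
def Tableau.profile (t : Tableau) (j k : ℕ) : ℕ :=
  firstRows (t.rows.map (List.filter (· ≤ j))) k

theorem Tableau.nodup_flatten (t : Tableau) : t.rows.flatten.Nodup :=
  t.entries.nodup_iff.2 List.nodup_range'

theorem Tableau.hasInc_iff (t : Tableau) (j k m : ℕ) :
    HasInc (t.reading.word.filter (· ≤ j)) k m ↔ m ≤ t.profile j k := by
  change HasInc ((readingWord t.rows).filter (· ≤ j)) k m ↔ _
  rw [readingWord_filter]
  refine hasInc_readingWord_iff ?_ (isChain_map_filter t.row_lt t.col_lt j) ?_ k m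
  · intro r hr
    obtain ⟨s, hs, rfl⟩ := List.mem_map.1 hr
    exact (t.row_lt s hs).filter _
  · rw [← List.filter_flatten]
    exact t.nodup_flatten.filter _

/-! ### A tableau is determined by its profile -/

/-- The entries are the points where the counting function jumps. -/
theorem eq_of_length_filter_le {r s : List ℕ} (hr : r.Pairwise (· < ·)) (hs : s.Pairwise (· < ·))
    (h : ∀ j, (r.filter (· ≤ j)).length = (s.filter (· ≤ j)).length) : r = s := by
  have key : ∀ {l : List ℕ}, l.Pairwise (· < ·) → ∀ x, x ∈ l ↔
      (l.filter (· ≤ x)).length ≠ (l.filter (fun z => z < x)).length := by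
    intro l hl x
    constructor
    · intro hx heq
      have hsub : (l.filter (fun z => z < x)).Sublist (l.filter (· ≤ x)) :=
        List.monotone_filter_right l fun z hz => by
          simp only [decide_eq_true_eq] at hz ⊢
          omega
      have := hsub.eq_of_length heq.symm
      have hmem : x ∈ l.filter (fun z => z < x) := this ▸ List.mem_filter.2 ⟨hx, by simp⟩
      simp at hmem
    · intro hne
      by_contra hx
      refine hne (congrArg List.length (List.filter_congr fun z hz => ?_))
      have : z ≠ x := fun h => hx (h ▸ hz)
      simp only [decide_eq_decide]
      omega
  have hlt : ∀ x, (r.filter (fun z => z < x)).length = (s.filter (fun z => z < x)).length := by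
    intro x
    cases x with
    | zero => simp
    | succ x => simpa [Nat.lt_succ_iff] using h x
  refine List.Perm.eq_of_pairwise' hr hs
    ((List.perm_ext_iff_of_nodup (hr.imp ne_of_lt) (hs.imp ne_of_lt)).2 fun x => ?_)
  rw [key hr, key hs, h, hlt]

/-- Differences in `k` give the counting function of each row; nonemptiness of the rows makes their
number detectable. -/
theorem rows_eq_of_firstRows_eq {s t : List (List ℕ)} (hs : ∀ r ∈ s, r ≠ [] ∧ r.Pairwise (· < ·))
    (ht : ∀ r ∈ t, r ≠ [] ∧ r.Pairwise (· < ·))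
    (h : ∀ j k, firstRows (s.map (List.filter (· ≤ j))) k =
      firstRows (t.map (List.filter (· ≤ j))) k) : s = t := by
  have hne : ∀ {r : List ℕ}, r ≠ [] → ∃ j, (r.filter (· ≤ j)).length ≠ 0 := by
    intro r hr
    obtain ⟨a, r, rfl⟩ := List.exists_cons_of_ne_nil hr
    exact ⟨a, by simp⟩
  induction s generalizing t with
  | nil =>
    cases t with
    | nil => rfl
    | cons r t =>
      obtain ⟨j, hj⟩ := hne (ht r (by simp)).1
      exact absurd (by have := h j 1; simpa only [firstRows, List.map_nil, List.map_cons, List.take_nil,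
        List.take_succ_cons, List.take_zero, List.sum_nil, List.sum_cons, add_zero, eq_comm] using this) hj
  | cons q s ih =>
    cases t with
    | nil =>
      obtain ⟨j, hj⟩ := hne (hs q (by simp)).1
      exact absurd (by have := h j 1; simpa only [firstRows, List.map_nil, List.map_cons, List.take_nil,
        List.take_succ_cons, List.take_zero, List.sum_nil, List.sum_cons, add_zero, eq_comm] using this) hj
    | cons r t =>
      have h1 : ∀ j, (q.filter (· ≤ j)).length = (r.filter (· ≤ j)).length := by
        intro j
        simpa [firstRows] using h j 1
      obtain rfl := eq_of_length_filter_le (hs q (by simp)).2 (ht r (by simp)).2 h1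
      refine congrArg _ (ih (fun p hp => hs p (by simp [hp])) (fun p hp => ht p (by simp [hp]))
        fun j k => ?_)
      simpa [firstRows] using h j (k + 1)

theorem Tableau.eq_of_profile_eq {s t : Tableau} (h : ∀ j k, s.profile j k = t.profile j k) :
    s = t :=
  Tableau.ext (rows_eq_of_firstRows_eq (fun r hr => ⟨s.ne_nil r hr, s.row_lt r hr⟩)
    (fun r hr => ⟨t.ne_nil r hr, t.row_lt r hr⟩) h)

/-- Knuth equivalence survives restriction to the letters `≤ j` and preserves the Greene invariants,
hence the whole profile. -/
theorem Tableau.eq_of_knuth {s t : Tableau} (h : Knuth s.reading.word t.reading.word) : s = t := by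
  refine Tableau.eq_of_profile_eq fun j k => ?_
  have h' := h.filter (· ≤ j) (fun a b c _ _ _ => by simp only [decide_eq_true_eq]; omega)
  have key : ∀ m, m ≤ s.profile j k ↔ m ≤ t.profile j k := fun m => by
    rw [← hasInc_iff, ← hasInc_iff, h'.hasInc_iff (s.reading.nodup.filter _)]
  exact le_antisymm ((key _).1 le_rfl) ((key _).2 le_rfl)

/-! ### Schensted tableaux and Knuth classes -/

theorem PermWord.knuth_reading_P (σ : PermWord) : Knuth σ.word σ.P.reading.word :=
  knuth_schensted σ.nodup

theorem PermWord.P_eq_iff {σ τ : PermWord} : σ.P = τ.P ↔ Knuth σ.word τ.word :=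
  ⟨fun h => σ.knuth_reading_P.trans (h ▸ τ.knuth_reading_P.symm), fun h =>
    Tableau.eq_of_knuth ((σ.knuth_reading_P.symm.trans h).trans τ.knuth_reading_P)⟩

theorem Tableau.P_reading (t : Tableau) : t.reading.P = t :=
  Tableau.eq_of_knuth t.reading.knuth_reading_P.symm

/-! ### Restriction to intervals of letters -/

theorem length_filter_le_range' (n x : ℕ) (hx : x ≤ n) :
    ((List.range' 1 n).filter fun y => y ≤ x).length = x := by
  induction n generalizing x with
  | zero => simpa using (Nat.le_zero.1 hx).symm
  | succ n ih =>
    rw [List.range'_concat, List.filter_append, List.length_append]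
    rcases Nat.lt_or_ge n x with h | h
    · obtain rfl : x = n + 1 := by omega
      rw [List.filter_eq_self.2 (fun y hy => by
        rw [List.mem_range'_1] at hy
        simp only [decide_eq_true_eq]
        omega)]
      simp [add_comm]
    · rw [ih x h]
      have : ¬ 1 + n ≤ x := by omega
      simp [this]

theorem PermWord.length_filter_le (σ : PermWord) {x : ℕ} (hx : x ≤ σ.word.length) :
    (σ.word.filter fun y => y ≤ x).length = x := by
  rw [(σ.isPerm.filter _).length_eq, length_filter_le_range' _ _ hx]

/-- The letters kept are an initial interval, so each is its own rank. -/
theorem PermWord.lower_word (σ : PermWord) (i : ℕ) :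
    (σ.lower i).word = σ.word.filter fun x => x ≤ i := by
  change stdWord _ = _
  unfold stdWord
  conv_rhs => rw [← List.map_id (σ.word.filter fun x => x ≤ i)]
  refine List.map_congr_left fun x hx => ?_
  obtain ⟨hx, hxi⟩ := List.mem_filter.1 hx
  rw [decide_eq_true_eq] at hxi
  rw [List.filter_filter, List.filter_congr (q := fun y => decide (y ≤ x)) (fun y _ => by
    rw [← Bool.decide_and, decide_eq_decide]
    omega)]
  exact σ.length_filter_le ((σ.mem_iff x).1 hx).2

theorem PermWord.upper_word (σ : PermWord) (i : ℕ) :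
    (σ.upper i).word = (σ.word.filter fun x => i < x).map (· - i) := by
  change stdWord _ = _
  refine List.map_congr_left fun x hx => ?_
  obtain ⟨hx, hxi⟩ := List.mem_filter.1 hx
  rw [decide_eq_true_eq] at hxi
  have hxn := ((σ.mem_iff x).1 hx).2
  have h1 := σ.length_filter_le hxn
  have h2 := σ.length_filter_le (x := i) (by omega)
  -- The `x` letters `≤ x` split into the `i` letters `≤ i` and those counted by the rank.
  have h3 := List.length_eq_length_filter_add (l := σ.word.filter fun y => y ≤ x)
    (fun y => decide (i < y))
  rw [List.filter_filter, List.filter_filter] at h3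
  rw [List.filter_filter]
  have h4 : (σ.word.filter fun y => (!decide (i < y)) && decide (y ≤ x)) =
      σ.word.filter fun y => decide (y ≤ i) := by
    refine List.filter_congr fun y _ => ?_
    rw [Bool.eq_iff_iff]
    simp only [Bool.and_eq_true, Bool.not_eq_true', decide_eq_false_iff_not, decide_eq_true_eq]
    omega
  have h5 : (σ.word.filter fun y => decide (y ≤ x) && decide (i < y)) =
      σ.word.filter fun y => decide (i < y) && decide (y ≤ x) := by
    simp only [Bool.and_comm]
  rw [h4] at h3
  rw [h5]
  omega

theorem PermWord.upper_word_map_add (σ : PermWord) (i : ℕ) :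
    (σ.upper i).word.map (· + i) = σ.word.filter fun x => i < x := by
  rw [upper_word, List.map_map]
  conv_rhs => rw [← List.map_id (σ.word.filter fun x => i < x)]
  refine List.map_congr_left fun x hx => ?_
  have := (List.mem_filter.1 hx).2
  simp only [decide_eq_true_eq] at this
  simp only [Function.comp_apply, id]
  omega

theorem PermWord.length_lower (σ : PermWord) {i : ℕ} (hi : i ≤ σ.word.length) :
    (σ.lower i).word.length = i := by
  rw [lower_word, σ.length_filter_le hi]

theorem PermWord.lower_tri (v u : PermWord) : (v.tri u).lower u.word.length = u := by
  apply PermWord.ext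
  rw [lower_word]
  change (v.word.map (fun x => x + u.word.length) ++ u.word).filter _ = _
  rw [List.filter_append, List.filter_eq_nil_iff.2, List.filter_eq_self.2, List.nil_append]
  · intro x hx
    simpa using ((u.mem_iff x).1 hx).2
  · intro x hx
    obtain ⟨y, hy, rfl⟩ := List.mem_map.1 hx
    have := (v.mem_iff y).1 hy
    simp only [decide_eq_true_eq]
    omega

theorem PermWord.upper_tri (v u : PermWord) : (v.tri u).upper u.word.length = v := by
  apply PermWord.ext
  refine List.map_injective_iff.2 (add_left_injective u.word.length) ?_
  change List.map (· + u.word.length) _ = _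
  rw [upper_word_map_add]
  change (v.word.map (fun x => x + u.word.length) ++ u.word).filter _ = _
  rw [List.filter_append, List.filter_eq_self.2, List.filter_eq_nil_iff.2, List.append_nil]
  · intro x hx
    simpa using ((u.mem_iff x).1 hx).2
  · intro x hx
    obtain ⟨y, hy, rfl⟩ := List.mem_map.1 hx
    have := (v.mem_iff y).1 hy
    simp only [decide_eq_true_eq]
    omega

/-! ### Compatibility of Knuth equivalence with restriction and shifted concatenation -/

theorem PermWord.P_lower_congr {σ τ : PermWord} (h : σ.P = τ.P) (i : ℕ) :
    (σ.lower i).P = (τ.lower i).P := by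
  rw [P_eq_iff] at h ⊢
  rw [lower_word, lower_word]
  exact h.filter _ fun a b c _ _ _ => by simp only [decide_eq_true_eq]; omega

theorem PermWord.P_upper_congr {σ τ : PermWord} (h : σ.P = τ.P) (i : ℕ) :
    (σ.upper i).P = (τ.upper i).P := by
  rw [P_eq_iff] at h ⊢
  rw [upper_word, upper_word]
  refine (h.filter _ fun a b c hab _ ha _ => ?_).map _ fun a ha b hb hab => ?_
  · simp only [decide_eq_true_eq] at ha ⊢
    omega
  · have := (List.mem_filter.1 ha).2
    simp only [decide_eq_true_eq] at this
    exact Nat.sub_lt_sub_right this.le hab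

theorem PermWord.P_tri_congr {v v' u u' : PermWord} (hv : v.P = v'.P) (hu : u.P = u'.P) :
    (v.tri u).P = (v'.tri u').P := by
  rw [P_eq_iff] at hv hu ⊢
  have h := hv.map (fun x => x + u.word.length) ((add_left_strictMono).strictMonoOn _)
  have := h.append hu
  change Knuth (v.word.map (fun x => x + u.word.length) ++ u.word)
    (v'.word.map (fun x => x + u'.word.length) ++ u'.word)
  rwa [← hu.perm.length_eq]

theorem PermWord.P_tri (v u : PermWord) : (v.tri u).P = v.P.tri u.P :=
  P_tri_congr v.P.P_reading.symm u.P.P_reading.symm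

/-! ### The weak orders -/

theorem inversions_filter {u v : List ℕ} (h : inversions u ⊆ inversions v) (p : ℕ → Bool) :
    inversions (u.filter p) ⊆ inversions (v.filter p) := by
  rintro ⟨a, b⟩ ⟨hlt, hs⟩
  have h1 := h ⟨hlt, hs.trans List.filter_sublist⟩
  refine ⟨hlt, ?_⟩
  have h2 := h1.2.filter p
  rwa [List.filter_eq_self.2 fun z hz => (List.mem_filter.1 (hs.subset hz)).2] at h2

theorem inversions_map {u v : List ℕ} (h : inversions u ⊆ inversions v) (f : ℕ → ℕ)
    (hf : StrictMonoOn f {x | x ∈ u}) : inversions (u.map f) ⊆ inversions (v.map f) := by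
  rintro ⟨a, b⟩ ⟨hlt, hs⟩
  obtain ⟨l, hl, he⟩ := List.sublist_map_iff.1 hs
  match l, hl, he with
  | [c, d], hl, he =>
    simp only [List.map_cons, List.map_nil, List.cons.injEq, and_true] at he
    obtain ⟨rfl, rfl⟩ := he
    have hc : c ∈ u := hl.subset (by simp)
    have hd : d ∈ u := hl.subset (by simp)
    have h1 : (c, d) ∈ inversions v := h ⟨(hf.lt_iff_lt hd hc).1 hlt, hl⟩
    exact ⟨hlt, h1.2.map f⟩

theorem pair_sublist_append_iff {a b : ℕ} {u v : List ℕ} :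
    [a, b].Sublist (u ++ v) ↔ [a, b].Sublist u ∨ [a, b].Sublist v ∨ a ∈ u ∧ b ∈ v := by
  constructor
  · intro h
    obtain ⟨l₁, l₂, he, h₁, h₂⟩ := List.sublist_append_iff.1 h
    match l₁, he with
    | [], he =>
      obtain rfl : l₂ = [a, b] := he.symm
      exact Or.inr (Or.inl h₂)
    | [c], he =>
      simp only [List.cons_append, List.nil_append, List.cons.injEq] at he
      obtain ⟨rfl, rfl⟩ := he
      exact Or.inr (Or.inr ⟨by simpa using h₁, by simpa using h₂⟩)
    | c :: d :: l, he =>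
      simp only [List.cons_append, List.cons.injEq, List.nil_eq, List.append_eq_nil_iff] at he
      obtain ⟨rfl, rfl, rfl, rfl⟩ := he
      exact Or.inl h₁
  · rintro (h | h | ⟨ha, hb⟩)
    · exact h.trans (List.sublist_append_left _ _)
    · exact h.trans (List.sublist_append_right _ _)
    · exact (List.singleton_sublist.2 ha).append (List.singleton_sublist.2 hb)

namespace PermWord

theorem WeakLE.refl (u : PermWord) : u.WeakLE u := ⟨rfl, subset_rfl⟩

theorem WeakLE.perm {u v : PermWord} (h : u.WeakLE v) : u.word.Perm v.word :=
  u.isPerm.trans (h.1 ▸ v.isPerm.symm)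

theorem WeakLE.lower {u v : PermWord} (h : u.WeakLE v) (i : ℕ) :
    (u.lower i).WeakLE (v.lower i) := by
  refine ⟨?_, ?_⟩
  · rw [lower_word, lower_word]
    exact (h.perm.filter _).length_eq
  · rw [lower_word, lower_word]
    exact inversions_filter h.2 _

theorem WeakLE.upper {u v : PermWord} (h : u.WeakLE v) (i : ℕ) :
    (u.upper i).WeakLE (v.upper i) := by
  refine ⟨?_, ?_⟩
  · rw [upper_word, upper_word]
    exact ((h.perm.filter _).map _).length_eq
  · rw [upper_word, upper_word]
    refine inversions_map (inversions_filter h.2 _) _ fun a ha b hb hab => ?_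
    have := (List.mem_filter.1 ha).2
    simp only [decide_eq_true_eq] at this
    exact Nat.sub_lt_sub_right this.le hab

theorem WeakLE.tri {v v' u u' : PermWord} (hv : v.WeakLE v') (hu : u.WeakLE u') :
    (v.tri u).WeakLE (v'.tri u') := by
  refine ⟨by simp [PermWord.tri, hv.1, hu.1], ?_⟩
  have h := inversions_map hv.2 (fun x => x + u.word.length)
    ((add_left_strictMono).strictMonoOn _)
  rintro ⟨a, b⟩ ⟨hlt, hs⟩
  refine ⟨hlt, ?_⟩
  change [a, b].Sublist (v.word.map (fun x => x + u.word.length) ++ u.word) at hs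
  change [a, b].Sublist (v'.word.map (fun x => x + u'.word.length) ++ u'.word)
  rw [← hu.1]
  rw [pair_sublist_append_iff] at hs ⊢
  rcases hs with hs | hs | ⟨ha, hb⟩
  · exact Or.inl (h ⟨hlt, hs⟩).2
  · exact Or.inr (Or.inl (hu.2 ⟨hlt, hs⟩).2)
  · exact Or.inr (Or.inr ⟨(hv.perm.map _).subset ha, hu.perm.subset hb⟩)

/-- Moving all letters `> i` before the letters `≤ i` inverts every mixed pair and keeps the
relative order of all others, so no inversion is lost. -/
theorem weakLE_tri_upper_lower (σ : PermWord) {i : ℕ} (hi : i ≤ σ.word.length) :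
    σ.WeakLE ((σ.upper i).tri (σ.lower i)) := by
  have hw : ((σ.upper i).tri (σ.lower i)).word =
      (σ.word.filter fun x => i < x) ++ σ.word.filter fun x => x ≤ i := by
    rw [← upper_word_map_add, ← lower_word]
    conv_rhs => rw [← σ.length_lower hi]
    change _ ++ _ = _
    rw [σ.length_lower hi]
  refine ⟨?_, ?_⟩
  · rw [hw, List.length_append, List.length_eq_length_filter_add (fun x => decide (i < x))]
    simp only [← decide_not, not_lt]
  · rintro ⟨a, b⟩ ⟨hlt, hs⟩
    refine ⟨hlt, ?_⟩
    simp only at hlt hs ⊢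
    rw [hw, pair_sublist_append_iff]
    have ha : a ∈ σ.word := hs.subset (by simp)
    have hb : b ∈ σ.word := hs.subset (by simp)
    by_cases hbi : i < b
    · left
      have := hs.filter (fun x => decide (i < x))
      simpa [hbi, hbi.trans hlt] using this
    · by_cases hai : i < a
      · right; right
        simp [ha, hb, hai, not_lt.1 hbi]
      · right; left
        have := hs.filter (fun x => decide (x ≤ i))
        simpa [not_lt.1 hbi, not_lt.1 hai] using this

end PermWord

/-! ### Taskin's order on tableaux: antisymmetry and compatibility with restriction and
concatenation. -/

namespace Tableau

theorem WeakLE.refl (t : Tableau) : t.WeakLE t :=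
  .single ⟨t.reading, t.reading, t.P_reading, t.P_reading, .refl _⟩

theorem WeakLE.trans {s t u : Tableau} (h : s.WeakLE t) (h' : t.WeakLE u) : s.WeakLE u :=
  Relation.TransGen.trans h h'

/-- Fewer inversions leave room for larger unions of increasing subwords, so the Greene invariants
decrease along the order. -/
theorem WeakLE.profile_le {s t : Tableau} (h : s.WeakLE t) (j k : ℕ) :
    t.profile j k ≤ s.profile j k := by
  have key : ∀ {u v : PermWord}, u.WeakLE v → v.P.profile j k ≤ u.P.profile j k := by
    intro u v huv
    have hK : ∀ (w : PermWord) m,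
        HasInc (w.word.filter (· ≤ j)) k m ↔ m ≤ w.P.profile j k := fun w m => by
      rw [← hasInc_iff]
      exact (w.knuth_reading_P.filter _
        (fun a b c _ _ _ => by simp only [decide_eq_true_eq]; omega)).hasInc_iff
          (w.nodup.filter _) k m
    exact (hK u _).1 (((hK v _).2 le_rfl).of_inversions (huv.perm.filter _) (u.nodup.filter _)
      (inversions_filter huv.2 _))
  induction h with
  | single h =>
    obtain ⟨u, v, rfl, rfl, h⟩ := h
    exact key h
  | tail _ h ih =>
    obtain ⟨u, v, rfl, rfl, h⟩ := h
    exact (key h).trans ih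

theorem WeakLE.antisymm {s t : Tableau} (h : s.WeakLE t) (h' : t.WeakLE s) : s = t :=
  eq_of_profile_eq fun j k => le_antisymm (h'.profile_le j k) (h.profile_le j k)

theorem weakLE_P {u v : PermWord} (h : u.WeakLE v) :
    u.P.WeakLE v.P :=
  .single ⟨u, v, rfl, rfl, h⟩

theorem WeakLE.lower {s t : Tableau} (h : s.WeakLE t) (i : ℕ) :
    (s.reading.lower i).P.WeakLE (t.reading.lower i).P := by
  refine Relation.TransGen.lift (fun t : Tableau => (t.reading.lower i).P) ?_ _ _ h
  rintro _ _ ⟨u, v, rfl, rfl, h⟩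
  exact ⟨u.lower i, v.lower i, PermWord.P_lower_congr u.P.P_reading.symm i,
    PermWord.P_lower_congr v.P.P_reading.symm i, h.lower i⟩

theorem WeakLE.upper {s t : Tableau} (h : s.WeakLE t) (i : ℕ) :
    (s.reading.upper i).P.WeakLE (t.reading.upper i).P := by
  refine Relation.TransGen.lift (fun t : Tableau => (t.reading.upper i).P) ?_ _ _ h
  rintro _ _ ⟨u, v, rfl, rfl, h⟩
  exact ⟨u.upper i, v.upper i, PermWord.P_upper_congr u.P.P_reading.symm i,
    PermWord.P_upper_congr v.P.P_reading.symm i, h.upper i⟩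

theorem WeakLE.tri {V V' U U' : Tableau} (hV : V.WeakLE V') (hU : U.WeakLE U') :
    (V.tri U).WeakLE (V'.tri U') := by
  refine WeakLE.trans (t := V'.tri U) ?_ ?_
  · refine Relation.TransGen.lift (fun V : Tableau => V.tri U) ?_ _ _ hV
    rintro _ _ ⟨u, v, rfl, rfl, h⟩
    exact ⟨u.tri U.reading, v.tri U.reading, by rw [PermWord.P_tri, P_reading],
      by rw [PermWord.P_tri, P_reading], h.tri (.refl _)⟩
  · refine Relation.TransGen.lift (fun U : Tableau => V'.tri U) ?_ _ _ hU
    rintro _ _ ⟨u, v, rfl, rfl, h⟩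
    exact ⟨V'.reading.tri u, V'.reading.tri v, by rw [PermWord.P_tri, P_reading],
      by rw [PermWord.P_tri, P_reading], (PermWord.WeakLE.refl _).tri h⟩

theorem lower_tri (V U : Tableau) : ((V.tri U).reading.lower U.size).P = U := by
  have h : (V.tri U).reading.P = (V.reading.tri U.reading).P := P_reading _
  rw [PermWord.P_lower_congr h, ← U.length_reading, PermWord.lower_tri, P_reading]

theorem upper_tri (V U : Tableau) : ((V.tri U).reading.upper U.size).P = V := by
  have h : (V.tri U).reading.P = (V.reading.tri U.reading).P := P_reading _
  rw [PermWord.P_upper_congr h, ← U.length_reading, PermWord.upper_tri, P_reading]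

theorem size_lower (t : Tableau) {i : ℕ} (hi : i ≤ t.size) :
    (t.reading.lower i).P.size = i := by
  rw [PermWord.size_P, PermWord.length_lower _ (by rwa [length_reading])]

/-- A Galois-type connection between the shifted concatenation and the restrictions to initial and
final intervals. -/
theorem weakLE_tri_iff {t V U : Tableau} :
    t.WeakLE (V.tri U) ↔ ∃ i ≤ t.size,
      (t.reading.lower i).P.WeakLE U ∧ (t.reading.upper i).P.WeakLE V := by
  constructor
  · intro h
    refine ⟨U.size, ?_, ?_, ?_⟩
    · have := h.size_eq
      rw [size_tri] at this
      omega
    · simpa only [lower_tri] using h.lower U.size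
    · simpa only [upper_tri] using h.upper U.size
  · rintro ⟨i, hi, hU, hV⟩
    -- It remains to compare `t` with the concatenation of its own two restrictions.
    refine WeakLE.trans ?_ (hV.tri hU)
    rw [← PermWord.P_tri]
    have := weakLE_P (t.reading.weakLE_tri_upper_lower (i := i) (by rwa [length_reading]))
    rwa [P_reading] at this

@[simp] theorem mem_above {t W : Tableau} : W ∈ t.above ↔ t.WeakLE W := by simp [above]

@[simp] theorem mem_factorizations {t : Tableau} {x : Tableau × Tableau} :
    x ∈ t.factorizations ↔ x.2.tri x.1 = t := by simp [factorizations]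

/-- Antisymmetry makes the number of tableaux above a strictly decreasing measure, which drives all
recursions along the order. -/
theorem WeakLE.card_above_lt {t W : Tableau} (h : t.WeakLE W) (hne : W ≠ t) :
    W.above.card < t.above.card := by
  refine Finset.card_lt_card ⟨fun x hx => ?_, fun hs => ?_⟩
  · simp only [mem_above] at hx ⊢
    exact h.trans hx
  · exact hne ((mem_above.1 (hs (mem_above.2 (.refl t)))).antisymm h)

end Tableau

/-! ### Möbius inversion and the monomial basis -/

open Classical in
theorem sum_above_eq {A : Type*} [AddCommGroup A] (F : Tableau → A) (t : Tableau) :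
    ∑ W ∈ t.above, F W = F t + ∑ W ∈ t.above.erase t, F W :=
  (Finset.add_sum_erase _ _ (by simp [Tableau.WeakLE.refl])).symm

/-- Möbius inversion without the Möbius function: the sums are unitriangular for the order. It
yields uniqueness of the monomial basis as well as the coproduct formula. -/
theorem eq_of_sum_above_eq {A : Type*} [AddCommGroup A] {F G : Tableau → A}
    (h : ∀ t : Tableau, ∑ W ∈ t.above, F W = ∑ W ∈ t.above, G W) : F = G := by
  classical
  funext t
  induction hn : t.above.card using Nat.strong_induction_on generalizing t with
  | _ n ih =>
    have ht := h t
    rw [sum_above_eq, sum_above_eq] at ht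
    rw [Finset.sum_congr rfl (g := G)] at ht
    · exact add_right_cancel ht
    · intro W hW
      simp only [Finset.mem_erase, Tableau.mem_above] at hW
      exact ih _ (hn ▸ hW.2.card_above_lt hW.1) W rfl

open Classical in
/-- The elements `M_t` of the monomial basis of `ℤT`. -/
noncomputable def monomialElt (t : Tableau) : ZT :=
  t.toZT - ∑ W : {W // W ∈ t.above.erase t}, monomialElt W.1
termination_by t.above.card
decreasing_by
  have hW := W.2
  simp only [Finset.mem_erase, Tableau.mem_above] at hW
  exact hW.2.card_above_lt hW.1

theorem isMonomial_monomialElt : IsMonomial monomialElt := by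
  classical
  intro t
  rw [sum_above_eq, monomialElt, ← Finset.sum_coe_sort (t.above.erase t)]
  exact (sub_add_cancel _ _).symm

/-- The linear endomorphism of `ℤT` sending `t` to the sum of the tableaux `W ≥ t`. -/
noncomputable def zetaMap : ZT →ₗ[ℤ] ZT :=
  Finsupp.linearCombination ℤ fun t : Tableau => ∑ W ∈ t.above, W.toZT

/-- The linear endomorphism of `ℤT` sending `t` to `M_t`. -/
noncomputable def moebiusMap : ZT →ₗ[ℤ] ZT := Finsupp.linearCombination ℤ monomialElt

theorem moebiusMap_toZT (t : Tableau) : moebiusMap t.toZT = monomialElt t := by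
  simp [moebiusMap, Tableau.toZT]

theorem zetaMap_toZT (t : Tableau) : zetaMap t.toZT = ∑ W ∈ t.above, W.toZT := by
  simp [zetaMap, Tableau.toZT]

theorem zetaMap_monomialElt (t : Tableau) : zetaMap (monomialElt t) = t.toZT := by
  refine congrFun (f := fun t => zetaMap (monomialElt t)) (eq_of_sum_above_eq fun s => ?_) t
  rw [← map_sum, ← isMonomial_monomialElt s, zetaMap_toZT]

theorem zT_hom_ext {A : Type*} [AddCommGroup A] {f g : ZT →ₗ[ℤ] A}
    (h : ∀ t : Tableau, f t.toZT = g t.toZT) : f = g :=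
  Finsupp.lhom_ext' fun t => LinearMap.ext_ring (h t)

/-- The monomial basis of `ℤT`. -/
noncomputable def monomialBasis : Module.Basis Tableau ℤ ZT :=
  .ofRepr (LinearEquiv.ofLinearMap zetaMap moebiusMap
    (zT_hom_ext fun t => by simp [moebiusMap_toZT, zetaMap_monomialElt])
    (zT_hom_ext fun t => by
      simp [zetaMap_toZT, moebiusMap_toZT, ← isMonomial_monomialElt t]))

@[simp] theorem coe_monomialBasis : ⇑monomialBasis = monomialElt := by
  rw [monomialBasis, Module.Basis.coe_ofRepr]
  exact funext moebiusMap_toZT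

/-! ### The coproduct -/

theorem map_linP_deltaS (σ : PermWord) :
    TensorProduct.map linP linP (deltaS σ.toZS) =
      ∑ i ∈ Finset.range (σ.word.length + 1),
        (σ.lower i).P.toZT ⊗ₜ[ℤ] (σ.upper i).P.toZT := by
  simp [deltaS, PermWord.toZS, linP]

theorem deltaT_toZT (t : Tableau) :
    deltaT t.toZT = ∑ i ∈ Finset.range (t.size + 1),
        (t.reading.lower i).P.toZT ⊗ₜ[ℤ] (t.reading.upper i).P.toZT := by
  rw [← t.length_reading, ← map_linP_deltaS]
  simp [deltaT, Tableau.toZT]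

theorem deltaT_P (σ : PermWord) :
    deltaT σ.P.toZT = TensorProduct.map linP linP (deltaS σ.toZS) := by
  rw [deltaT_toZT, map_linP_deltaS, σ.size_P]
  refine Finset.sum_congr rfl fun i _ => ?_
  rw [PermWord.P_lower_congr σ.P.P_reading, PermWord.P_upper_congr σ.P.P_reading]

/-- By Möbius inversion it suffices to compare sums over `W ≥ s`, where both sides become sums of
the same terms over sets of pairs `(U, V)`. -/
theorem deltaT_monomialElt (t : Tableau) :
    deltaT (monomialElt t) =
      ∑ x ∈ t.factorizations, monomialElt x.1 ⊗ₜ[ℤ] monomialElt x.2 := by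
  classical
  refine congrFun (f := fun t => deltaT (monomialElt t))
    (g := fun t => ∑ x ∈ t.factorizations, monomialElt x.1 ⊗ₜ[ℤ] monomialElt x.2)
    (eq_of_sum_above_eq fun s => ?_) t
  rw [← map_sum, ← isMonomial_monomialElt s, deltaT_toZT, ← Finset.sum_biUnion]
  · simp_rw [isMonomial_monomialElt (PermWord.P _), TensorProduct.sum_tmul,
      TensorProduct.tmul_sum, ← Finset.sum_product']
    rw [← Finset.sum_biUnion]
    · refine Finset.sum_congr (Finset.ext fun x => ?_) fun _ _ => rfl
      simp only [Finset.mem_biUnion, Finset.mem_range, Nat.lt_succ_iff, Finset.mem_product,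
        Tableau.mem_above, Tableau.mem_factorizations, exists_eq_right']
      exact Tableau.weakLE_tri_iff.symm
    -- The index `i` is the size of `U`, so no pair occurs for two indices.
    · intro i hi j hj hij
      refine Finset.disjoint_left.2 fun x hxi hxj => hij ?_
      simp only [Finset.mem_product, Tableau.mem_above] at hxi hxj
      simp only [Finset.coe_range, Set.mem_Iio, Nat.lt_succ_iff] at hi hj
      rw [← s.size_lower hi, ← s.size_lower hj, ← hxi.1.size_eq, hxj.1.size_eq]
  -- A pair is a factorization of only one tableau, its product.
  · intro V _ W _ hVW
    refine Finset.disjoint_left.2 fun x hV hW => hVW ?_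
    rw [Tableau.mem_factorizations] at hV hW
    exact hV.symm.trans hW

end TableauHopf

/-- The monomial basis of the Hopf algebra of tableaux and its coproduct. The first two clauses say that
the coproduct of `ℤT` and the product `△` of tableaux are indeed those induced by the ones of
permutations, whichever permutations are chosen to represent the tableaux. -/
theorem theorem2 :
    (∀ σ : TableauHopf.PermWord,
      TableauHopf.deltaT σ.P.toZT =
        TensorProduct.map TableauHopf.linP TableauHopf.linP (TableauHopf.deltaS σ.toZS)) ∧
    (∀ u v : TableauHopf.PermWord, (v.tri u).P = v.P.tri u.P) ∧
    ∃ M : Module.Basis TableauHopf.Tableau ℤ TableauHopf.ZT,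
      TableauHopf.IsMonomial M ∧
      (∀ M' : TableauHopf.Tableau → TableauHopf.ZT, TableauHopf.IsMonomial M' → M' = M) ∧
      ∀ t : TableauHopf.Tableau,
        TableauHopf.deltaT (M t) = ∑ x ∈ t.factorizations, M x.1 ⊗ₜ[ℤ] M x.2 := by
  refine ⟨TableauHopf.deltaT_P, fun u v => v.P_tri u, TableauHopf.monomialBasis, ?_, ?_, ?_⟩
  · rw [TableauHopf.coe_monomialBasis]
    exact TableauHopf.isMonomial_monomialElt
  · intro M' hM'
    rw [TableauHopf.coe_monomialBasis]
    exact TableauHopf.eq_of_sum_above_eq fun t =>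
      (hM' t).symm.trans (TableauHopf.isMonomial_monomialElt t)
  · intro t
    rw [TableauHopf.coe_monomialBasis]
    exact TableauHopf.deltaT_monomialElt t
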